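/- All graphs are finite and simple, not necessarily connected. A \emph{drawing} of a graph in the plane represents vertices by distinct points and every edge by a simple polygonal arc joining its two ends and containing no other vertex. It is a \emph{plane drawing} if distinct edges meet only at vertices. It is \emph{1-planar} if adjacent edges do not cross and every edge is crossed at most once, where a crossing is a common point of two edges that is not a vertex; a graph is \emph{1-planar} if it has a 1-planar drawing. The faces of a plane drawing are the connected components of its complement, and a vertex or edge is incident with a face if it is contained in the boundary of the face; the unbounded face is the outer face. A plane drawing is \emph{outerplane} if all its vertices are incident with the outer face, and \emph{2-outerplane} if deleting all vertices incident with the outer face leaves an outerplane drawing. For a face $f$, let $i(f)$ be the number of vertices incident with $f$ but not with the outer face, and let $c(f)$ be the number of edges incident with both $f$ and the outer face. The join $G+P_1$ is obtained from $G$ by adding one new vertex adjacent to all vertices of $G$. \textbf{Proposition.} Let $D$ be a 2-outerplane drawing of a graph $G$. (1) If $i(f)\le c(f)$ for every non-outer face $f$ which is adjacent to the outer face in the sense that some vertex is incident with both, then $G+P_1$ is 1-planar. (2) If $i(f)\le c(f)$ for every non-outer face $f$ which is adjacent to the outer face in the sense that some edge is incident with both, and every vertex not incident with the outer face is incident with at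 least one such face, then $G+P_1$ is 1-planar. -/

import Mathlib

namespace SimpleGraph

/-- The Euclidean plane. -/
abbrev Plane : Type := EuclideanSpace ℝ (Fin 2)

/-- `IsPolygonalArc a b S`: the set `S` is a simple (non-self-intersecting) arc from `a` to `b`
made of finitely many straight line segments. -/
inductive IsPolygonalArc : Plane → Plane → Set Plane → Prop
  | segment (a b : Plane) (hab : a ≠ b) : IsPolygonalArc a b (_root_.segment ℝ a b)
  | cons (a b c : Plane) (S : Set Plane) (hab : a ≠ b) (hS : IsPolygonalArc b c S)
      (hinter : _root_.segment ℝ a b ∩ S = {b}) :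
      IsPolygonalArc a c (_root_.segment ℝ a b ∪ S)

/-- A drawing of `G` in the plane: distinct vertices are distinct points, every edge is a simple
arc joining its two ends, and an edge passes through no vertex other than its ends.
Distinct edges may still meet. Only the values of `arc` at edges of `G` matter. -/
structure Drawing {V : Type*} (G : SimpleGraph V) where
  pos : V → Plane
  pos_injective : Function.Injective pos
  arc : Sym2 V → Set Plane
  isArc : ∀ u v : V, G.Adj u v → IsPolygonalArc (pos u) (pos v) (arc s(u, v))
  mem_of_pos_mem : ∀ e ∈ G.edgeSet, ∀ w : V, pos w ∈ arc e → w ∈ e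

namespace Drawing

variable {V : Type*} {G : SimpleGraph V}

/-- The drawing is a plane graph: distinct edges meet only at vertices
(hence only at common ends). -/
def IsPlane (D : Drawing G) : Prop :=
  ∀ e ∈ G.edgeSet, ∀ e' ∈ G.edgeSet, e ≠ e' → D.arc e ∩ D.arc e' ⊆ Set.range D.pos

/-- The crossings on the edge `e`: pairs consisting of another edge and a common point of the two
arcs which is not a vertex. -/
def crossingsOn (D : Drawing G) (e : Sym2 V) : Set (Sym2 V × Plane) :=
  {c | c.1 ∈ G.edgeSet ∧ c.1 ≠ e ∧ c.2 ∈ D.arc e ∧ c.2 ∈ D.arc c.1 ∧ c.2 ∉ Set.range D.pos}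

/-- The drawing is 1-planar: every edge is crossed at most once, and adjacent edges
do not cross. -/
def IsOnePlanar (D : Drawing G) : Prop :=
  (∀ e ∈ G.edgeSet, (D.crossingsOn e).Subsingleton) ∧
  (∀ e ∈ G.edgeSet, ∀ c ∈ D.crossingsOn e, ∀ v : V, v ∈ e → v ∉ c.1)

/-- The set of points of the plane covered by the drawing. -/
def support (D : Drawing G) : Set Plane :=
  Set.range D.pos ∪ ⋃ e ∈ G.edgeSet, D.arc e

/-- The faces: connected components of the complement of the drawing. -/
def IsFace (D : Drawing G) (f : Set Plane) : Prop :=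
  ∃ p ∈ D.supportᶜ, f = connectedComponentIn D.supportᶜ p

/-- The outer face: the points whose component in the complement of the drawing is unbounded
(for a finite graph there is exactly one unbounded component). -/
def outerFace (D : Drawing G) : Set Plane :=
  {p | p ∈ D.supportᶜ ∧ ¬ Bornology.IsBounded (connectedComponentIn D.supportᶜ p)}

/-- The vertices incident with the face `f`. -/
def faceVerts (D : Drawing G) (f : Set Plane) : Set V :=
  {v | D.pos v ∈ frontier f}

/-- The edges incident with the face `f`. -/
def faceEdges (D : Drawing G) (f : Set Plane) : Set (Sym2 V) :=
  {e | e ∈ G.edgeSet ∧ D.arc e ⊆ frontier f}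

/-- The plane drawing obtained by keeping only the vertices in `s` and the edges between them. -/
def induce (D : Drawing G) (s : Set V) : Drawing (G.induce s) where
  pos v := D.pos v
  pos_injective := D.pos_injective.comp Subtype.val_injective
  arc e := D.arc (e.map Subtype.val)
  isArc u v h := D.isArc u v h
  mem_of_pos_mem := by
    intro e
    induction e using Sym2.ind with
    | _ u v =>
      intro he w hw
      have h := D.mem_of_pos_mem s(u.1, v.1) he w.1 hw
      rw [Sym2.mem_iff] at h ⊢
      exact h.imp Subtype.ext Subtype.ext

/-- An outerplane drawing: a plane drawing with all vertices incident with the outer face. -/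
def IsOuterplane (D : Drawing G) : Prop :=
  D.IsPlane ∧ ∀ v : V, v ∈ D.faceVerts D.outerFace

/-- A 2-outerplane drawing: a plane drawing which becomes outerplane when all vertices incident
with its outer face are deleted. -/
def IsTwoOuterplane (D : Drawing G) : Prop :=
  D.IsPlane ∧ (D.induce (D.faceVerts D.outerFace)ᶜ).IsOuterplane

/-- `f` is a face, other than the outer one, sharing at least one edge with the outer face. -/
def IsEdgeExposed (D : Drawing G) (f : Set Plane) : Prop :=
  D.IsFace f ∧ f ≠ D.outerFace ∧ (D.faceEdges f ∩ D.faceEdges D.outerFace).Nonempty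

/-- `f` is a face, other than the outer one, sharing at least one vertex with the outer face. -/
def IsVertexExposed (D : Drawing G) (f : Set Plane) : Prop :=
  D.IsFace f ∧ f ≠ D.outerFace ∧ (D.faceVerts f ∩ D.faceVerts D.outerFace).Nonempty

/-- The number of vertices of `f` not incident with the outer face is at most the number of
common edges of `f` and the outer face. -/
def FewInnerVerts (D : Drawing G) (f : Set Plane) : Prop :=
  (D.faceVerts f \ D.faceVerts D.outerFace).ncard ≤
    (D.faceEdges f ∩ D.faceEdges D.outerFace).ncard

end Drawing

/-- A graph is 1-planar if it has a 1-planar drawing. -/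
def OnePlanar {V : Type*} (G : SimpleGraph V) : Prop :=
  ∃ D : Drawing G, D.IsOnePlanar

/-- The join of two graphs: their disjoint union together with all edges between them. -/
def joinGraph {V W : Type*} (G : SimpleGraph V) (H : SimpleGraph W) : SimpleGraph (V ⊕ W) :=
  (G ⊕g H) ⊔ completeBipartiteGraph V W

end SimpleGraph

/-! Both parts rest on one construction. The new vertex is a point `p` of the outer face. A vertex
incident with the outer face is joined to `p` inside that face. An inner vertex `v` is assigned to a
face `f` that is incident with it and shares an edge with the outer face. As `i(f) ≤ c(f)`, the
vertices assigned to `f` can be matched by disjoint arcs inside `f` with points on distinct edges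
common to `f` and the outer face; from these points the arcs continue to `p`. Each new edge then has
at most one crossing, and since `v` is inner, the edge it crosses does not end at `v`. An old edge
is crossed at most once: besides the outer face it borders at most one face
(`IsRegion.eq_of_mem_frontier`), and within that face distinct vertices use distinct edges.

Part (1) reduces to part (2). In a 2-outerplane drawing every inner vertex lies on a face `f`
sharing a vertex with the outer face (`exists_isVertexExposed`). Hence `1 ≤ i(f) ≤ c(f)`, so `f`
shares an edge with it as well.

The topology needs no Jordan curve theorem. A finite union of segments is locally a cone, so the
boundary points of a face are accessible by segments. `IsRegion.exists_star` joins one point of a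
face to finitely many boundary points by arcs meeting only at their origin. For the matching
(`IsRegion.exists_matching`), a star is cut off at a small circle around its centre, and the points
on the circle are paired by disjoint chords, found by minimising total length. -/

open Set Metric Filter Topology MeasureTheory
open scoped Convex

namespace SimpleGraph

/-! ### Polygonal arcs: concatenation, cutting and connectedness. -/

namespace IsPolygonalArc

variable {a b c : Plane} {S T W : Set Plane}

theorem ne (h : IsPolygonalArc a b S) : a ≠ b := by
  induction h with
  | segment a b hab => exact hab
  | cons a b c S hab hS hinter ih =>
    rintro rfl
    have hc : a ∈ S := by
      clear ih hinter hab
      induction hS with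
      | segment a b hab => exact right_mem_segment ℝ a b
      | cons a b c S hab hS hinter ih => exact Or.inr ih
    have : a ∈ [a -[ℝ] b] ∩ S := ⟨left_mem_segment ℝ a b, hc⟩
    rw [hinter] at this
    exact hab this

theorem left_mem (h : IsPolygonalArc a b S) : a ∈ S := by
  cases h with
  | segment a b hab => exact left_mem_segment ℝ a b
  | cons a b c S hab hS hinter => exact Or.inl (left_mem_segment ℝ a b)

theorem right_mem (h : IsPolygonalArc a b S) : b ∈ S := by
  induction h with
  | segment a b hab => exact right_mem_segment ℝ a b
  | cons a b c S hab hS hinter ih => exact Or.inr ih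

theorem isCompact_segment (a b : Plane) : IsCompact [a -[ℝ] b] := by
  rw [segment_eq_image']
  exact isCompact_Icc.image (by fun_prop)

theorem isCompact (h : IsPolygonalArc a b S) : IsCompact S := by
  induction h with
  | segment a b hab => exact isCompact_segment a b
  | cons a b c S hab hS hinter ih => exact (isCompact_segment a b).union ih

theorem isClosed (h : IsPolygonalArc a b S) : IsClosed S := h.isCompact.isClosed

theorem trans (h : IsPolygonalArc a b S) (h' : IsPolygonalArc b c T) (hST : S ∩ T ⊆ {b}) :
    IsPolygonalArc a c (S ∪ T) := by
  induction h with
  | segment a b hab =>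
    exact cons a b c T hab h' (hST.antisymm
      (singleton_subset_iff.2 ⟨right_mem_segment ℝ a b, h'.left_mem⟩))
  | cons a b d S hab hS hinter ih =>
    rw [union_assoc]
    have h1 := ih h' (fun z hz => hST ⟨Or.inr hz.1, hz.2⟩)
    refine cons a b c _ hab h1 (Subset.antisymm ?_ (singleton_subset_iff.2
      ⟨right_mem_segment ℝ a b, h1.left_mem⟩))
    rintro z ⟨hz, hz' | hz'⟩
    · exact hinter.subset ⟨hz, hz'⟩
    · have := hST ⟨Or.inl hz, hz'⟩
      rw [mem_singleton_iff] at this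
      subst this
      exact hinter.subset ⟨hz, hS.right_mem⟩

theorem symm (h : IsPolygonalArc a b S) : IsPolygonalArc b a S := by
  induction h with
  | segment a b hab => rw [segment_symm]; exact segment b a hab.symm
  | cons a b c S hab hS hinter ih =>
    rw [segment_symm, union_comm]
    refine ih.trans (segment b a hab.symm) ?_
    rw [segment_symm, inter_comm, hinter]

theorem exists_subarc (h : IsPolygonalArc a b S) {z : Plane} (hz : z ∈ S) (hza : z ≠ a) :
    ∃ S' ⊆ S, IsPolygonalArc a z S' := by
  induction h with
  | segment a b hab =>
    exact ⟨_, (convex_segment a b).segment_subset (left_mem_segment ℝ a b) hz,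
      segment a z hza.symm⟩
  | cons a b c S hab hS hinter ih =>
    by_cases hz1 : z ∈ [a -[ℝ] b]
    · exact ⟨_, ((convex_segment a b).segment_subset (left_mem_segment ℝ a b) hz1).trans
        subset_union_left, segment a z hza.symm⟩
    · have hzS := hz.resolve_left hz1
      obtain ⟨S', hS', h'⟩ := ih hzS (fun h => hz1 (h ▸ right_mem_segment ℝ a b))
      refine ⟨_, union_subset_union_right _ hS', cons a b z S' hab h' (Subset.antisymm ?_ ?_)⟩
      · exact (inter_subset_inter_right _ hS').trans hinter.subset
      · exact singleton_subset_iff.2 ⟨right_mem_segment ℝ a b, h'.left_mem⟩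

/-- The segment may run back across `S`. Leaving `S` at the point of `S ∩ [b, c]` nearest to `c`
makes the rest of the segment meet `S` only there. -/
theorem exists_extend (h : IsPolygonalArc a b S) (hac : a ≠ c) :
    ∃ R ⊆ S ∪ [b -[ℝ] c], IsPolygonalArc a c R := by
  by_cases hc : c ∈ S
  · obtain ⟨S', hS', h'⟩ := h.exists_subarc hc hac.symm
    exact ⟨S', hS'.trans subset_union_left, h'⟩
  obtain ⟨z, ⟨hzS, hzc⟩, hmin⟩ := (h.isCompact.inter (isCompact_segment b c)).exists_isMinOn
    ⟨b, h.right_mem, left_mem_segment ℝ b c⟩ (f := fun z => Dist.dist z c) (by fun_prop)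
  have hsub : [z -[ℝ] c] ⊆ [b -[ℝ] c] :=
    (convex_segment b c).segment_subset hzc (right_mem_segment ℝ b c)
  have hzc' : z ≠ c := fun h => hc (h ▸ hzS)
  by_cases hza : z = a
  · subst hza
    exact ⟨_, hsub.trans subset_union_right, segment z c hzc'⟩
  · obtain ⟨S', hS', h'⟩ := h.exists_subarc hzS hza
    refine ⟨_, union_subset_union hS' hsub, h'.trans (segment z c hzc') ?_⟩
    rintro y ⟨hyS, hy⟩
    have h1 : Dist.dist z c ≤ Dist.dist y c := hmin ⟨hS' hyS, hsub hy⟩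
    have h2 := dist_add_dist_of_mem_segment hy
    have h3 : Dist.dist z y = 0 := le_antisymm (by linarith) dist_nonneg
    exact (dist_eq_zero.1 h3).symm

/-- The arcs may intersect arbitrarily: the second is appended segment by segment, and loops are cut
off on the way. -/
theorem exists_join (h : IsPolygonalArc a b S) (h' : IsPolygonalArc b c T) (hac : a ≠ c) :
    ∃ R ⊆ S ∪ T, IsPolygonalArc a c R := by
  induction h' generalizing S with
  | segment b c hbc => exact h.exists_extend hac
  | cons b d c T hbd hT hinter ih =>
    by_cases had : a = d
    · subst had
      exact ⟨T, subset_union_of_subset_right subset_union_right _, hT⟩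
    · obtain ⟨R, hR, h1⟩ := h.exists_extend had
      obtain ⟨R', hR', h2⟩ := ih h1 hac
      refine ⟨R', hR'.trans ?_, h2⟩
      rw [← union_assoc]
      exact union_subset_union_left _ hR

/-- Being equal or joined by an arc in `W` is an equivalence relation that holds locally, because
discs are convex. -/
theorem exists_of_isPreconnected (hW : IsOpen W) (hW' : IsPreconnected W) (ha : a ∈ W)
    (hb : b ∈ W) (hab : a ≠ b) : ∃ S ⊆ W, IsPolygonalArc a b S := by
  have key := hW'.induction₂ (fun x y => x = y ∨ ∃ S ⊆ W, IsPolygonalArc x y S)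
    (fun x hx => ?_) (fun x y z hx hy hz h1 h2 => ?_) (fun x y hx hy h => ?_) ha hb
  · exact key.resolve_left hab
  · obtain ⟨r, hr, hrW⟩ := Metric.isOpen_iff.1 hW x hx
    filter_upwards [mem_nhdsWithin_of_mem_nhds (ball_mem_nhds x hr)] with y hy
    by_cases hxy : x = y
    · exact Or.inl hxy
    · exact Or.inr ⟨_, ((convex_ball x r).segment_subset (Metric.mem_ball_self hr) hy).trans hrW,
        segment x y hxy⟩
  · rcases h1 with rfl | ⟨S, hS, h1⟩
    · exact h2
    rcases h2 with rfl | ⟨T, hT, h2⟩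
    · exact Or.inr ⟨S, hS, h1⟩
    by_cases hxz : x = z
    · exact Or.inl hxz
    · obtain ⟨R, hR, h⟩ := h1.exists_join h2 hxz
      exact Or.inr ⟨R, hR.trans (union_subset hS hT), h⟩
  · rcases h with rfl | ⟨S, hS, h⟩
    · exact Or.inl rfl
    · exact Or.inr ⟨S, hS, h.symm⟩

theorem segment_eq_union_of_mem {v : Plane} (hv : v ∈ [a -[ℝ] b]) :
    [a -[ℝ] b] = [a -[ℝ] v] ∪ [v -[ℝ] b] := by
  rw [segment_eq_image_lineMap] at hv
  obtain ⟨t, ht, rfl⟩ := hv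
  have h0 : AffineMap.lineMap a b (0 : ℝ) = a := AffineMap.lineMap_apply_zero a b
  have h1 : AffineMap.lineMap a b (1 : ℝ) = b := AffineMap.lineMap_apply_one a b
  have key : ∀ r s : ℝ, r ≤ s → [AffineMap.lineMap a b r -[ℝ] AffineMap.lineMap a b s] =
      AffineMap.lineMap a b '' Icc r s := fun r s hrs => by
    rw [← image_segment, segment_eq_Icc hrs]
  have h2 := key 0 1 zero_le_one
  have h3 := key 0 t ht.1
  have h4 := key t 1 ht.2
  rw [h0, h1] at h2
  rw [h0] at h3
  rw [h1] at h4
  rw [h2, h3, h4, ← image_union, Icc_union_Icc_eq_Icc ht.1 ht.2]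

theorem isPreconnected_diff_right (h : IsPolygonalArc a b S) : IsPreconnected (S \ {b}) := by
  induction h with
  | segment a b hab =>
    have : [a -[ℝ] b] \ {b} = insert a (openSegment ℝ a b) := by
      rw [← insert_endpoints_openSegment]
      ext z
      simp only [Set.mem_sdiff, mem_insert_iff, mem_singleton_iff]
      constructor
      · tauto
      · rintro (rfl | h)
        · exact ⟨Or.inl rfl, hab⟩
        · refine ⟨Or.inr (Or.inr h), ?_⟩
          rintro rfl
          exact hab (right_mem_openSegment_iff.1 h)
    rw [this]
    refine (convex_openSegment a b).isPreconnected.subset_closure (subset_insert _ _) ?_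
    rw [closure_openSegment]
    exact insert_subset (left_mem_segment ℝ a b) (openSegment_subset_segment ℝ a b)
  | cons a b c S hab hS hinter ih =>
    have hc : c ∉ [a -[ℝ] b] := fun hc =>
      hS.ne (hinter.subset ⟨hc, hS.right_mem⟩ : c = b).symm
    rw [union_sdiff_distrib, sdiff_singleton_eq_self hc]
    exact IsPreconnected.union b (right_mem_segment ℝ a b) ⟨hS.left_mem, hS.ne⟩
      (convex_segment a b).isPreconnected ih

theorem isPreconnected_diff (h : IsPolygonalArc a b S) : IsPreconnected (S \ {a, b}) := by
  cases h with
  | segment a b hab =>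
    have : [a -[ℝ] b] \ {a, b} = openSegment ℝ a b := by
      rw [← insert_endpoints_openSegment]
      ext z
      simp only [Set.mem_sdiff, mem_insert_iff, mem_singleton_iff]
      constructor
      · tauto
      · intro h
        refine ⟨Or.inr (Or.inr h), ?_⟩
        rintro (rfl | rfl)
        · exact hab (left_mem_openSegment_iff.1 h)
        · exact hab (right_mem_openSegment_iff.1 h)
    rw [this]
    exact (convex_openSegment a b).isPreconnected
  | cons a d b S hab hS hinter =>
    have hc : b ∉ [a -[ℝ] d] := fun hc =>
      hS.ne (hinter.subset ⟨hc, hS.right_mem⟩ : b = d).symm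
    have ha : a ∉ S := fun ha => hab (hinter.subset ⟨left_mem_segment ℝ a d, ha⟩ : a = d)
    have : ([a -[ℝ] d] ∪ S) \ {a, b} = ([d -[ℝ] a] \ {a}) ∪ (S \ {b}) := by
      rw [segment_symm ℝ d a]
      ext z
      simp only [Set.mem_sdiff, mem_union, mem_insert_iff, mem_singleton_iff]
      constructor
      · tauto
      · rintro (⟨h1, h2⟩ | ⟨h1, h2⟩)
        · exact ⟨Or.inl h1, by rintro (h | rfl) <;> tauto⟩
        · exact ⟨Or.inr h1, by rintro (rfl | h) <;> tauto⟩
    rw [this]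
    exact IsPreconnected.union d ⟨left_mem_segment ℝ d a, hab.symm⟩ ⟨hS.left_mem, hS.ne⟩
      (segment d a hab.symm).isPreconnected_diff_right hS.isPreconnected_diff_right

/-- The initial piece of an arc is a radius of every sufficiently small disc at its origin. -/
theorem exists_trim (h : IsPolygonalArc a b S) :
    ∃ u : Plane, ‖u‖ = 1 ∧ ∃ r₀ > 0, ∀ r, 0 < r → r < r₀ → ∃ S',
      IsPolygonalArc (a + r • u) b S' ∧ S = [a -[ℝ] a + r • u] ∪ S' ∧
      S' ∩ closedBall a r ⊆ {a + r • u} := by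
  have seg : ∀ b : Plane, a ≠ b → ∃ u : Plane, ‖u‖ = 1 ∧ ∀ r, 0 < r → r < Dist.dist a b →
      a + r • u ≠ b ∧ [a -[ℝ] b] = [a -[ℝ] a + r • u] ∪ [a + r • u -[ℝ] b] ∧
      [a + r • u -[ℝ] b] ∩ closedBall a r ⊆ {a + r • u} := by
    intro b hab
    have hpos : 0 < ‖b - a‖ := norm_pos_iff.2 (sub_ne_zero.2 hab.symm)
    have hu : ‖(‖b - a‖⁻¹ • (b - a))‖ = 1 := by
      rw [norm_smul, norm_inv, norm_norm, inv_mul_cancel₀ hpos.ne']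
    refine ⟨‖b - a‖⁻¹ • (b - a), hu, fun r hr hr' => ?_⟩
    rw [dist_eq_norm'] at hr'
    set v := a + r • ‖b - a‖⁻¹ • (b - a) with hv
    have hav : Dist.dist a v = r := by
      rw [dist_eq_norm', hv, add_sub_cancel_left, norm_smul, hu, mul_one, Real.norm_of_nonneg hr.le]
    have hvs : v ∈ [a -[ℝ] b] := by
      rw [segment_eq_image']
      refine ⟨r * ‖b - a‖⁻¹, ⟨by positivity, ?_⟩, ?_⟩
      · rw [← div_eq_mul_inv, div_le_one hpos]; exact hr'.le
      · rw [hv, smul_smul]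
    refine ⟨?_, ?_, ?_⟩
    · intro h
      rw [h, dist_eq_norm'] at hav
      exact hr'.ne hav.symm
    · exact segment_eq_union_of_mem hvs
    · rintro z ⟨hz, hzr⟩
      have hz1 : Dist.dist a z ≤ r := by rw [_root_.dist_comm]; exact hzr
      have hvz : v ∈ [a -[ℝ] z] := by
        have h1 : Wbtw ℝ a v b := mem_segment_iff_wbtw.1 hvs
        have h2 : Wbtw ℝ v z b := mem_segment_iff_wbtw.1 hz
        exact mem_segment_iff_wbtw.2 (h1.trans_right_left h2)
      have := dist_add_dist_of_mem_segment hvz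
      have h3 : Dist.dist v z = 0 := le_antisymm (by linarith) dist_nonneg
      exact (dist_eq_zero.1 h3).symm
  cases h with
  | segment a b hab =>
    obtain ⟨u, hu, H⟩ := seg b hab
    refine ⟨u, hu, Dist.dist a b, dist_pos.2 hab, fun r hr hr' => ?_⟩
    obtain ⟨h1, h2, h3⟩ := H r hr hr'
    exact ⟨_, segment _ _ h1, h2, h3⟩
  | cons a d b S hab hS hinter =>
    obtain ⟨u, hu, H⟩ := seg d hab
    have ha : a ∈ Sᶜ := fun ha => hab (hinter.subset ⟨left_mem_segment ℝ a d, ha⟩ : a = d)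
    obtain ⟨ε, hε, hεS⟩ := Metric.isOpen_iff.1 hS.isClosed.isOpen_compl a ha
    -- Below `ε` the disc misses all later segments; below `dist a d` its circle cuts the first
    -- segment before its end.
    refine ⟨u, hu, min ε (Dist.dist a d), lt_min hε (dist_pos.2 hab), fun r hr hr' => ?_⟩
    obtain ⟨h1, h2, h3⟩ := H r hr (hr'.trans_le (min_le_right _ _))
    refine ⟨[a + r • u -[ℝ] d] ∪ S, cons _ _ _ _ h1 hS (Subset.antisymm ?_ ?_), ?_, ?_⟩
    · refine Subset.trans ?_ hinter.subset
      rw [h2]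
      exact inter_subset_inter_left _ subset_union_right
    · exact singleton_subset_iff.2 ⟨right_mem_segment ℝ _ _, hS.left_mem⟩
    · rw [← union_assoc, ← h2]
    · rintro z ⟨hz | hz, hzr⟩
      · exact h3 ⟨hz, hzr⟩
      · exact absurd hz (hεS (closedBall_subset_ball (hr'.trans_le (min_le_left _ _)) hzr))

end IsPolygonalArc

/-! ### Finite unions of segments and their local cone structure. -/

/-- Near `z`, the complement of `K` is closed under contraction towards `z`. -/
def ConicalAt (K : Set Plane) (z : Plane) : Prop :=
  ∃ r > 0, ∀ w ∈ Metric.ball z r, w ∉ K → ∀ t : ℝ, 0 < t → t ≤ 1 → z + t • (w - z) ∉ K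

theorem ConicalAt.union {K L : Set Plane} {z : Plane} (hK : ConicalAt K z) (hL : ConicalAt L z) :
    ConicalAt (K ∪ L) z := by
  obtain ⟨r, hr, H⟩ := hK
  obtain ⟨s, hs, H'⟩ := hL
  refine ⟨min r s, lt_min hr hs, fun w hw hwK t ht ht' h => ?_⟩
  rcases h with h | h
  · exact H w (ball_subset_ball (min_le_left _ _) hw) (fun h => hwK (Or.inl h)) t ht ht' h
  · exact H' w (ball_subset_ball (min_le_right _ _) hw) (fun h => hwK (Or.inr h)) t ht ht' h

theorem conicalAt_of_notMem {K : Set Plane} (hK : IsClosed K) {z : Plane} (hz : z ∉ K) :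
    ConicalAt K z := by
  obtain ⟨r, hr, H⟩ := Metric.isOpen_iff.1 hK.isOpen_compl z hz
  refine ⟨r, hr, fun w hw _ t ht ht' => H ?_⟩
  exact (convex_ball z r).add_smul_sub_mem (Metric.mem_ball_self hr) hw ⟨ht.le, ht'⟩

theorem conicalAt_segment_left (z a : Plane) : ConicalAt [z -[ℝ] a] z := by
  by_cases hza : z = a
  · subst hza
    refine ⟨1, one_pos, fun w _ hw t ht _ h => hw ?_⟩
    rw [segment_same, mem_singleton_iff] at h ⊢
    have : t • (w - z) = 0 := by simpa using h
    rcases smul_eq_zero.1 this with h | h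
    · exact absurd h ht.ne'
    · exact sub_eq_zero.1 h
  · have hpos : 0 < ‖a - z‖ := norm_pos_iff.2 (sub_ne_zero.2 (Ne.symm hza))
    -- If the contracted point lies on the segment, then `w` lies on the ray from `z` through `a`,
    -- and this radius keeps it before `a`.
    refine ⟨‖a - z‖, hpos, fun w hw hwK t ht ht' h => hwK ?_⟩
    rw [segment_eq_image'] at h ⊢
    obtain ⟨s, hs, hs'⟩ := h
    have e1 : w - z = (s / t) • (a - z) := by
      have : s • (a - z) = t • (w - z) := add_left_cancel hs'
      rw [div_eq_inv_mul, mul_smul, this, smul_smul, inv_mul_cancel₀ ht.ne', one_smul]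
    have hst : 0 ≤ s / t := div_nonneg hs.1 ht.le
    refine ⟨s / t, ⟨hst, ?_⟩, ?_⟩
    · rw [mem_ball_iff_norm, e1, norm_smul, Real.norm_of_nonneg hst] at hw
      nlinarith
    · simp only
      rw [← e1, add_sub_cancel]

theorem conicalAt_segment (a b z : Plane) : ConicalAt [a -[ℝ] b] z := by
  by_cases hz : z ∈ [a -[ℝ] b]
  · rw [IsPolygonalArc.segment_eq_union_of_mem hz, segment_symm ℝ a z]
    exact (conicalAt_segment_left z a).union (conicalAt_segment_left z b)
  · exact conicalAt_of_notMem (IsPolygonalArc.isCompact_segment a b).isClosed hz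

/-- The properties of finite unions of line segments that matter here. -/
structure IsPolygonalSet (K : Set Plane) : Prop where
  isCompact : IsCompact K
  conicalAt : ∀ z, ConicalAt K z
  volume_eq_zero : volume K = 0

namespace IsPolygonalSet

variable {K L : Set Plane}

theorem isClosed (hK : IsPolygonalSet K) : IsClosed K := hK.isCompact.isClosed

theorem union (hK : IsPolygonalSet K) (hL : IsPolygonalSet L) : IsPolygonalSet (K ∪ L) :=
  ⟨hK.isCompact.union hL.isCompact, fun z => (hK.conicalAt z).union (hL.conicalAt z),
    measure_union_null hK.volume_eq_zero hL.volume_eq_zero⟩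

theorem empty : IsPolygonalSet ∅ :=
  ⟨isCompact_empty, fun _ => conicalAt_of_notMem isClosed_empty (notMem_empty _), measure_empty⟩

theorem segment (a b : Plane) : IsPolygonalSet [a -[ℝ] b] := by
  refine ⟨IsPolygonalArc.isCompact_segment a b, conicalAt_segment a b, ?_⟩
  have hsub : [a -[ℝ] b] ⊆ affineSpan ℝ ({a, b} : Set Plane) := by
    rw [← convexHull_pair]
    exact convexHull_subset_affineSpan _
  refine measure_mono_null hsub (Measure.addHaar_affineSubspace _ _ fun h => ?_)
  have h1 : Module.finrank ℝ (affineSpan ℝ ({a, b} : Set Plane)).direction ≤ 1 := by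
    rw [direction_affineSpan, vectorSpan_pair]
    exact (finrank_span_le_card _).trans (by simp)
  rw [h, AffineSubspace.direction_top, finrank_top, finrank_euclideanSpace, Fintype.card_fin] at h1
  omega

theorem singleton (a : Plane) : IsPolygonalSet {a} := by
  rw [← segment_same ℝ a]
  exact segment a a

theorem biUnion {ι : Type*} {s : Set ι} (hs : s.Finite) {f : ι → Set Plane}
    (hf : ∀ i ∈ s, IsPolygonalSet (f i)) : IsPolygonalSet (⋃ i ∈ s, f i) := by
  induction s, hs using Set.Finite.induction_on with
  | empty => simpa using empty
  | insert _ _ ih =>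
    rw [biUnion_insert]
    exact (hf _ (mem_insert _ _)).union (ih fun i hi => hf i (mem_insert_of_mem _ hi))

/-- The source of accessibility: by conicality, a nearby point off `K` sees `z` along a straight
segment. -/
theorem exists_disjoint_segment (hK : IsPolygonalSet K) (z : Plane) :
    ∃ r > 0, ∀ w ∈ Metric.ball z r, w ∉ K → Disjoint ([w -[ℝ] z] \ {z}) K := by
  obtain ⟨r, hr, H⟩ := hK.conicalAt z
  refine ⟨r, hr, fun w hw hwK => Set.disjoint_left.2 ?_⟩
  rintro x ⟨hx, hxz⟩
  rw [segment_symm, segment_eq_image'] at hx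
  obtain ⟨t, ht, rfl⟩ := hx
  refine H w hw hwK t (ht.1.lt_of_ne' ?_) ht.2
  rintro rfl
  simp at hxz

end IsPolygonalSet

theorem IsPolygonalArc.isPolygonalSet {a b : Plane} {S : Set Plane} (h : IsPolygonalArc a b S) :
    IsPolygonalSet S := by
  induction h with
  | segment a b hab => exact .segment a b
  | cons a b c S hab hS hinter ih => exact (IsPolygonalSet.segment a b).union ih

/-! ### Components of the complement of a closed set. -/

/-- `W` is a connected component of the complement of the closed set `K`. -/
structure IsRegion (K W : Set Plane) : Prop where
  isOpen : IsOpen W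
  isPreconnected : IsPreconnected W
  nonempty : W.Nonempty
  disjoint : Disjoint W K
  frontier_subset : frontier W ⊆ K

namespace IsRegion

variable {K W W' : Set Plane}

/-- As the frontier of `W` lies in `K`, a set missing `K` is covered by the disjoint open sets `W`
and the complement of `closure W`. -/
theorem subset_of_isPreconnected (hW : IsRegion K W) {C : Set Plane} (hC : IsPreconnected C)
    (hCK : Disjoint C K) (h : (C ∩ W).Nonempty) : C ⊆ W := by
  refine hC.subset_left_of_subset_union hW.isOpen isClosed_closure.isOpen_compl
    (disjoint_compl_right.mono_left subset_closure) (fun x hx => ?_) h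
  by_cases hxW : x ∈ closure W
  · left
    by_contra hx'
    exact Set.disjoint_left.1 hCK hx (hW.frontier_subset ⟨hxW, by rwa [hW.isOpen.interior_eq]⟩)
  · exact Or.inr hxW

theorem eq_of_inter_nonempty (hW : IsRegion K W) (hW' : IsRegion K W') (h : (W ∩ W').Nonempty) :
    W = W' :=
  (hW'.subset_of_isPreconnected hW.isPreconnected hW.disjoint h).antisymm
    (hW.subset_of_isPreconnected hW'.isPreconnected hW'.disjoint (by rwa [inter_comm]))

theorem mem_frontier_iff (hW : IsRegion K W) {z : Plane} :
    z ∈ frontier W ↔ z ∈ closure W ∧ z ∈ K := by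
  refine ⟨fun h => ⟨h.1, hW.frontier_subset h⟩, fun h => ⟨h.1, ?_⟩⟩
  rw [hW.isOpen.interior_eq]
  exact fun hz => Set.disjoint_left.1 hW.disjoint hz h.2

theorem connectedComponentIn (hK : IsClosed K) {p : Plane} (hp : p ∉ K) :
    IsRegion K (connectedComponentIn Kᶜ p) := by
  have ho : ∀ q, IsOpen (_root_.connectedComponentIn Kᶜ q) := fun q =>
    hK.isOpen_compl.connectedComponentIn
  refine ⟨ho p, isPreconnected_connectedComponentIn, ⟨p, mem_connectedComponentIn hp⟩,
    disjoint_compl_left.mono_left (connectedComponentIn_subset _ _), fun z hz => ?_⟩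
  by_contra hzK
  obtain ⟨w, hw, hw'⟩ := mem_closure_iff.1 hz.1 _ (ho z) (mem_connectedComponentIn hzK)
  have h1 := connectedComponentIn_eq hw
  have h2 := connectedComponentIn_eq hw'
  apply hz.2
  rw [(ho p).interior_eq, h2, ← h1]
  exact mem_connectedComponentIn hzK

theorem eq_connectedComponentIn (hW : IsRegion K W) (hK : IsClosed K) {p : Plane} (hp : p ∈ W) :
    W = _root_.connectedComponentIn Kᶜ p := by
  have hpK : p ∉ K := Set.disjoint_left.1 hW.disjoint hp
  exact hW.eq_of_inter_nonempty (connectedComponentIn hK hpK)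
    ⟨p, hp, mem_connectedComponentIn hpK⟩

theorem exists_segment_subset (hW : IsRegion K W) (hK : IsPolygonalSet K) {z : Plane}
    (hz : z ∈ frontier W) : ∃ w ∈ W, w ≠ z ∧ [w -[ℝ] z] ⊆ insert z W := by
  obtain ⟨r, hr, H⟩ := hK.exists_disjoint_segment z
  obtain ⟨w, hw, hwW⟩ := mem_closure_iff.1 hz.1 _ isOpen_ball (Metric.mem_ball_self hr)
  have hwK : w ∉ K := Set.disjoint_left.1 hW.disjoint hwW
  have hne : w ≠ z := by
    rintro rfl
    exact hwK (hW.frontier_subset hz)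
  refine ⟨w, hwW, hne, ?_⟩
  rw [insert_eq, ← sdiff_subset_iff]
  exact hW.subset_of_isPreconnected
    (IsPolygonalArc.segment w z hne).isPreconnected_diff_right (H w hw hwK)
    ⟨w, ⟨left_mem_segment ℝ w z, hne⟩, hwW⟩

/-- Two points on the frontier of a region can be joined by an arc through the region. -/
theorem exists_arc (hW : IsRegion K W) (hK : IsPolygonalSet K) {u v : Plane}
    (hu : u ∈ frontier W) (hv : v ∈ frontier W) (huv : u ≠ v) :
    ∃ S ⊆ insert u (insert v W), IsPolygonalArc u v S := by
  obtain ⟨w, hw, hwu, hwS⟩ := hW.exists_segment_subset hK hu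
  obtain ⟨w', hw', hwv, hwS'⟩ := hW.exists_segment_subset hK hv
  have huW : u ∉ W := fun h => Set.disjoint_left.1 hW.disjoint h (hW.frontier_subset hu)
  have h1 : ∃ S ⊆ insert u W, IsPolygonalArc u w' S := by
    have h0 := (IsPolygonalArc.segment w u hwu).symm
    by_cases hww : w = w'
    · exact ⟨_, hwS, hww ▸ h0⟩
    · obtain ⟨S, hS, h⟩ := IsPolygonalArc.exists_of_isPreconnected hW.isOpen hW.isPreconnected
        hw hw' hww
      obtain ⟨R, hR, h'⟩ := h0.exists_join h (fun h => huW (h ▸ hw'))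
      exact ⟨R, hR.trans (union_subset hwS (hS.trans (subset_insert _ _))), h'⟩
  obtain ⟨S, hS, h⟩ := h1
  obtain ⟨R, hR, h'⟩ := h.exists_join (IsPolygonalArc.segment w' v hwv) huv
  refine ⟨R, hR.trans (union_subset (hS.trans (insert_subset_insert (subset_insert _ _)))
    (hwS'.trans (subset_insert _ _))), h'⟩

end IsRegion

/-! ### The two sides of an arc near an interior point. -/

namespace IsPolygonalArc

variable {a b : Plane} {S : Set Plane}

/-- An interior point splits an arc. -/
theorem exists_split (h : IsPolygonalArc a b S) {y : Plane} (hy : y ∈ S) (hya : y ≠ a)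
    (hyb : y ≠ b) : ∃ S₁ S₂, IsPolygonalArc y a S₁ ∧ IsPolygonalArc y b S₂ ∧ S = S₁ ∪ S₂ ∧
      S₁ ∩ S₂ ⊆ {y} := by
  have seg : ∀ a b : Plane, y ∈ [a -[ℝ] b] → [y -[ℝ] a] ∩ [y -[ℝ] b] ⊆ {y} := by
    rintro a b hy z ⟨hz, hz'⟩
    have h1 : Wbtw ℝ a y b := mem_segment_iff_wbtw.1 hy
    have h2 : Wbtw ℝ a z y := (mem_segment_iff_wbtw.1 hz).symm
    have h3 : Wbtw ℝ y z b := mem_segment_iff_wbtw.1 hz'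
    have h4 : Wbtw ℝ a y z := h1.trans_right_left h3
    exact (wbtw_swap_right_iff ℝ a).1 ⟨h2, h4⟩
  induction h with
  | segment a b hab =>
    exact ⟨_, _, segment y a hya, segment y b hyb, by
      rw [segment_symm ℝ y a]; exact segment_eq_union_of_mem hy, seg a b hy⟩
  | cons a d b S had hS hinter ih =>
    by_cases hy1 : y ∈ [a -[ℝ] d]
    · by_cases hyd : y = d
      · subst hyd
        exact ⟨_, _, segment y a hya, hS, by rw [segment_symm ℝ y a], by
          rw [segment_symm ℝ y a]; exact hinter.subset⟩
      · have hsub : [y -[ℝ] d] ⊆ [a -[ℝ] d] :=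
          (convex_segment a d).segment_subset hy1 (right_mem_segment ℝ a d)
        have hyS : y ∉ S := fun hyS => hyd (hinter.subset ⟨hy1, hyS⟩)
        refine ⟨_, _, segment y a hya, (segment y d hyd).trans hS ?_, ?_, ?_⟩
        · exact (inter_subset_inter_left _ hsub).trans hinter.subset
        · rw [← union_assoc, segment_symm ℝ y a, ← segment_eq_union_of_mem hy1]
        · rintro z ⟨hz, hz' | hz'⟩
          · exact seg a d hy1 ⟨hz, hz'⟩
          · have hz1 : z ∈ [a -[ℝ] d] :=
              (convex_segment a d).segment_subset hy1 (left_mem_segment ℝ a d) hz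
            have hzd : z = d := hinter.subset ⟨hz1, hz'⟩
            subst hzd
            exact seg a z hy1 ⟨hz, right_mem_segment ℝ y z⟩
    · have hyS := hy.resolve_left hy1
      have hyd : y ≠ d := fun h => hy1 (h ▸ right_mem_segment ℝ a d)
      obtain ⟨S₁, S₂, h1, h2, rfl, h3⟩ := ih hyS hyd hyb
      refine ⟨_, S₂, h1.trans (segment a d had).symm ?_, h2, ?_, ?_⟩
      · rintro z ⟨hz, hz'⟩
        exact hinter.subset ⟨hz', Or.inl hz⟩
      · rw [← union_assoc, union_comm S₁]
      · rintro z ⟨hz | hz, hz'⟩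
        · exact h3 ⟨hz, hz'⟩
        · have hzd : z = d := hinter.subset ⟨hz, Or.inr hz'⟩
          subst hzd
          exact h3 ⟨h1.right_mem, hz'⟩

end IsPolygonalArc

/-- The closed half-line from `z` in direction `u`. -/
def ray (z u : Plane) : Set Plane := {w | ∃ s : ℝ, 0 ≤ s ∧ w = z + s • u}

theorem IsPolygonalArc.exists_eq_ray {a b : Plane} {S : Set Plane} (h : IsPolygonalArc a b S) :
    ∃ u : Plane, ‖u‖ = 1 ∧ ∃ r > 0, S ∩ Metric.ball a r = ray a u ∩ Metric.ball a r := by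
  obtain ⟨u, hu, r₀, hr₀, H⟩ := h.exists_trim
  obtain ⟨S', -, h2, h3⟩ := H (r₀ / 2) (by linarith) (by linarith)
  set r := r₀ / 2 with hr
  have hr0 : 0 < r := by linarith
  have hnorm : ∀ s : ℝ, 0 ≤ s → Dist.dist (a + s • u) a = s := fun s hs => by
    rw [dist_eq_norm, add_sub_cancel_left, norm_smul, hu, mul_one, Real.norm_of_nonneg hs]
  refine ⟨u, hu, r, hr0, Subset.antisymm ?_ ?_⟩
  · rintro z ⟨hz, hzr⟩
    refine ⟨?_, hzr⟩
    rw [h2] at hz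
    rcases hz with hz | hz
    · rw [segment_eq_image'] at hz
      obtain ⟨t, ht, rfl⟩ := hz
      refine ⟨t * r, mul_nonneg ht.1 hr0.le, ?_⟩
      simp only [add_sub_cancel_left, smul_smul]
    · have : z = a + r • u := h3 ⟨hz, ball_subset_closedBall hzr⟩
      rw [Metric.mem_ball, this, hnorm r hr0.le] at hzr
      exact absurd hzr (lt_irrefl _)
  · rintro z ⟨⟨s, hs, rfl⟩, hzr⟩
    refine ⟨?_, hzr⟩
    rw [Metric.mem_ball, hnorm s hs] at hzr
    rw [h2, segment_eq_image']
    refine Or.inl ⟨s / r, ⟨div_nonneg hs hr0.le, (div_le_one hr0).2 hzr.le⟩, ?_⟩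
    simp only [add_sub_cancel_left, smul_smul]
    rw [div_mul_cancel₀ _ hr0.ne']

theorem IsPolygonalArc.exists_eq_rays {a b : Plane} {S : Set Plane} (h : IsPolygonalArc a b S)
    {y : Plane} (hy : y ∈ S) (hya : y ≠ a) (hyb : y ≠ b) :
    ∃ u v : Plane, ‖u‖ = 1 ∧ ‖v‖ = 1 ∧ u ≠ v ∧ ∃ r > 0,
      S ∩ Metric.ball y r = (ray y u ∪ ray y v) ∩ Metric.ball y r := by
  obtain ⟨S₁, S₂, h1, h2, rfl, h3⟩ := h.exists_split hy hya hyb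
  obtain ⟨u, hu, r, hr, H⟩ := h1.exists_eq_ray
  obtain ⟨v, hv, s, hs, H'⟩ := h2.exists_eq_ray
  have e1 : Metric.ball y (min r s) = Metric.ball y r ∩ Metric.ball y (min r s) :=
    (inter_eq_right.2 (ball_subset_ball (min_le_left _ _))).symm
  have e2 : Metric.ball y (min r s) = Metric.ball y s ∩ Metric.ball y (min r s) :=
    (inter_eq_right.2 (ball_subset_ball (min_le_right _ _))).symm
  have hpos : 0 < min r s := lt_min hr hs
  have K1 : S₁ ∩ Metric.ball y (min r s) = ray y u ∩ Metric.ball y (min r s) := by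
    rw [e1, ← inter_assoc, ← inter_assoc, H]
  have K2 : S₂ ∩ Metric.ball y (min r s) = ray y v ∩ Metric.ball y (min r s) := by
    rw [e2, ← inter_assoc, ← inter_assoc, H']
  refine ⟨u, v, hu, hv, ?_, min r s, hpos, ?_⟩
  · rintro rfl
    have hz : y + (min r s / 2) • u ∈ ray y u ∩ Metric.ball y (min r s) := by
      refine ⟨⟨_, by positivity, rfl⟩, ?_⟩
      rw [mem_ball_iff_norm, add_sub_cancel_left, norm_smul, hu, mul_one,
        Real.norm_of_nonneg (by positivity)]
      linarith
    have h4 : y + (min r s / 2) • u = y := h3 ⟨(K1 ▸ hz).1, (K2 ▸ hz).1⟩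
    have h5 : (min r s / 2) • u = 0 := by simpa using h4
    rcases smul_eq_zero.1 h5 with h | h
    · linarith
    · rw [h, norm_zero] at hu
      exact zero_ne_one hu
  · rw [union_inter_distrib_right, union_inter_distrib_right, K1, K2]

/-- The open circular sector of radius `r` between the angles `α` and `γ`. -/
def sector (r α γ : ℝ) : Set ℂ :=
  (fun p : ℝ × ℝ => (p.1 : ℂ) * Complex.exp (p.2 * Complex.I)) '' (Ioo 0 r ×ˢ Ioo α γ)

theorem isPreconnected_sector (r α γ : ℝ) : IsPreconnected (sector r α γ) :=
  (isPreconnected_Ioo.prod isPreconnected_Ioo).image _ (by fun_prop)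

theorem mem_closure_sector {r α γ s θ : ℝ} (hαγ : α < γ) (hθ : θ ∈ Icc α γ) (hs : 0 ≤ s)
    (hsr : s < r) : (s : ℂ) * Complex.exp (θ * Complex.I) ∈ closure (sector r α γ) := by
  refine image_closure_subset_closure_image (by fun_prop) ⟨(s, θ), ?_, rfl⟩
  rw [closure_prod_eq, closure_Ioo hαγ.ne, closure_Ioo (hs.trans_lt hsr).ne]
  exact ⟨⟨hs, hsr.le⟩, hθ⟩

/-- Uniqueness of polar coordinates when the angles differ by less than a full turn; the radius `s`
may a priori be zero. -/
theorem eq_of_mul_exp_eq {ρ s θ β : ℝ} (hρ : 0 < ρ) (hs : 0 ≤ s) (h : |θ - β| < 2 * Real.pi)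
    (heq : (ρ : ℂ) * Complex.exp (θ * Complex.I) = s * Complex.exp (β * Complex.I)) : θ = β := by
  have h1 := congrArg norm heq
  rw [norm_mul, norm_mul, Complex.norm_exp_ofReal_mul_I, Complex.norm_exp_ofReal_mul_I,
    Complex.norm_of_nonneg hρ.le, Complex.norm_of_nonneg hs, mul_one, mul_one] at h1
  rw [← h1] at heq
  have h2 := mul_left_cancel₀ (by exact_mod_cast hρ.ne') heq
  obtain ⟨n, hn⟩ := Complex.exp_eq_exp_iff_exists_int.1 h2
  have h3 : θ = β + n * (2 * Real.pi) := by
    have := congrArg Complex.im hn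
    simpa using this
  have hpi := Real.pi_pos
  rw [h3, add_sub_cancel_left, abs_mul, abs_of_pos (by positivity : (0 : ℝ) < 2 * Real.pi)] at h
  have h4 : |(n : ℝ)| < 1 := by
    by_contra hcon
    push Not at hcon
    nlinarith
  have h5 : |n| < 1 := by exact_mod_cast h4
  rw [Int.abs_lt_one_iff] at h5
  rw [h3, h5]
  simp

theorem union_sector {r β : ℝ} (hβ : β ∈ Ioo 0 (2 * Real.pi)) :
    sector r 0 β ∪ sector r β (2 * Real.pi) = Metric.ball 0 r \
      {w : ℂ | ∃ s : ℝ, 0 ≤ s ∧ (w = s ∨ w = s * Complex.exp (β * Complex.I))} := by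
  ext w
  constructor
  · intro hw
    obtain ⟨ρ, θ, hρ, hθ, hθβ, rfl⟩ : ∃ ρ θ : ℝ, ρ ∈ Ioo 0 r ∧ θ ∈ Ioo 0 (2 * Real.pi) ∧ θ ≠ β ∧
        (ρ : ℂ) * Complex.exp (θ * Complex.I) = w := by
      rcases hw with ⟨⟨ρ, θ⟩, ⟨h1, h2⟩, rfl⟩ | ⟨⟨ρ, θ⟩, ⟨h1, h2⟩, rfl⟩
      · exact ⟨ρ, θ, h1, ⟨h2.1, h2.2.trans hβ.2⟩, h2.2.ne, rfl⟩
      · exact ⟨ρ, θ, h1, ⟨hβ.1.trans h2.1, h2.2⟩, h2.1.ne', rfl⟩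
    refine ⟨?_, ?_⟩
    · rw [mem_ball_zero_iff, norm_mul, Complex.norm_exp_ofReal_mul_I,
        Complex.norm_of_nonneg hρ.1.le, mul_one]
      exact hρ.2
    · rintro ⟨s, hs, h | h⟩
      · have : (ρ : ℂ) * Complex.exp (θ * Complex.I) = s * Complex.exp ((0 : ℝ) * Complex.I) := by
          rw [h]; simp
        have := eq_of_mul_exp_eq hρ.1 hs
          (by rw [sub_zero, abs_of_pos hθ.1]; exact hθ.2) this
        exact hθ.1.ne' this
      · refine hθβ (eq_of_mul_exp_eq hρ.1 hs ?_ h)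
        rw [abs_lt]
        constructor <;> linarith [hθ.1, hθ.2, hβ.1, hβ.2]
  · rintro ⟨hwr, hw⟩
    have hw0 : w ≠ 0 := by
      rintro rfl
      exact hw ⟨0, le_rfl, Or.inl (by simp)⟩
    have hwpos : 0 < ‖w‖ := norm_pos_iff.2 hw0
    -- Taking the argument of `-w` and adding `π` gives an angle in `(0, 2π]`, so the branch cut
    -- falls on the ray at angle zero.
    have hrep : (‖w‖ : ℂ) * Complex.exp ((Complex.arg (-w) + Real.pi : ℝ) * Complex.I) = w := by
      have := Complex.norm_mul_exp_arg_mul_I (-w)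
      rw [norm_neg] at this
      rw [Complex.ofReal_add, add_mul, Complex.exp_add, Complex.exp_pi_mul_I, ← mul_assoc, this]
      ring
    set θ := Complex.arg (-w) + Real.pi with hθ
    have h1 : 0 < θ := by linarith [Complex.neg_pi_lt_arg (-w)]
    have h2 : θ ≤ 2 * Real.pi := by linarith [Complex.arg_le_pi (-w)]
    have h3 : θ ≠ 2 * Real.pi := by
      intro h
      refine hw ⟨‖w‖, hwpos.le, Or.inl ?_⟩
      rw [h] at hrep
      push_cast at hrep
      rw [Complex.exp_two_pi_mul_I, mul_one] at hrep
      exact hrep.symm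
    have h4 : θ ≠ β := by
      intro h
      rw [h] at hrep
      exact hw ⟨‖w‖, hwpos.le, Or.inr hrep.symm⟩
    have hwr' : ‖w‖ ∈ Ioo 0 r := ⟨hwpos, by simpa using hwr⟩
    rcases lt_or_gt_of_ne h4 with h | h
    · exact Or.inl ⟨(‖w‖, θ), ⟨hwr', h1, h⟩, hrep⟩
    · exact Or.inr ⟨(‖w‖, θ), ⟨hwr', h, h2.lt_of_ne h3⟩, hrep⟩

/-- Two rays from the centre of a disc split it into two sectors. -/
theorem exists_sectors (y : Plane) {u v : Plane} (hu : ‖u‖ = 1) (hv : ‖v‖ = 1) (huv : u ≠ v)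
    (r : ℝ) : ∃ S₁ S₂ : Set Plane, IsPreconnected S₁ ∧ IsPreconnected S₂ ∧
      S₁ ∪ S₂ = Metric.ball y r \ (ray y u ∪ ray y v) ∧
      (ray y u ∪ ray y v) ∩ Metric.ball y r ⊆ closure S₁ ∧
      (ray y u ∪ ray y v) ∩ Metric.ball y r ⊆ closure S₂ := by
  set φ : ℂ ≃ₗᵢ[ℝ] Plane := Complex.orthonormalBasisOneI.repr with hφ
  set c := φ.symm u with hc
  have hcn : ‖c‖ = 1 := by rw [hc, LinearIsometryEquiv.norm_map, hu]
  have hc0 : c ≠ 0 := by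
    rintro h
    rw [h, norm_zero] at hcn
    exact zero_ne_one hcn
  set d := c⁻¹ * φ.symm v with hd
  have hdn : ‖d‖ = 1 := by
    rw [hd, norm_mul, norm_inv, hcn, LinearIsometryEquiv.norm_map, hv]; simp
  have hd1 : d ≠ 1 := by
    intro h
    apply huv
    apply φ.symm.injective
    rw [← hc]
    rw [hd, inv_mul_eq_one₀ hc0] at h
    exact h
  obtain ⟨β, hβ, hβd⟩ : ∃ β ∈ Ioo 0 (2 * Real.pi), Complex.exp (β * Complex.I) = d := by
    have hrep : Complex.exp ((Complex.arg (-d) + Real.pi : ℝ) * Complex.I) = d := by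
      have := Complex.norm_mul_exp_arg_mul_I (-d)
      rw [norm_neg, hdn] at this
      rw [Complex.ofReal_add, add_mul, Complex.exp_add, Complex.exp_pi_mul_I]
      simp only [Complex.ofReal_one, one_mul] at this
      rw [this]
      ring
    refine ⟨_, ⟨by linarith [Complex.neg_pi_lt_arg (-d)], lt_of_le_of_ne
      (by linarith [Complex.arg_le_pi (-d)]) ?_⟩, hrep⟩
    intro h
    rw [h] at hrep
    push_cast at hrep
    rw [Complex.exp_two_pi_mul_I] at hrep
    exact hd1 hrep.symm
  -- An isometry, because `‖c‖ = 1`. It sends the positive real axis to the ray in direction `u` and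
  -- the ray through `d` to the one in direction `v`.
  set ψ : ℂ → Plane := fun w => y + φ (c * w) with hψ
  have hψc : Continuous ψ := by fun_prop
  have hψs : Function.Surjective ψ := fun z => ⟨c⁻¹ * φ.symm (z - y), by simp [hψ, hc0]⟩
  have hψi : Function.Injective ψ := fun w w' h => by simpa [hψ, hc0] using h
  have hψn : ∀ w, Dist.dist (ψ w) y = ‖w‖ := fun w => by
    rw [dist_eq_norm, hψ]
    simp only [add_sub_cancel_left, LinearIsometryEquiv.norm_map, norm_mul, hcn, one_mul]
  have hψu : ∀ s : ℝ, ψ s = y + s • u := fun s => by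
    simp only [hψ]
    rw [mul_comm, ← Complex.real_smul, map_smul, hc, LinearIsometryEquiv.apply_symm_apply]
  have hψv : ∀ s : ℝ, ψ (s * d) = y + s • v := fun s => by
    simp only [hψ]
    rw [← mul_assoc, mul_comm c, mul_assoc, hd, mul_inv_cancel_left₀ hc0, ← Complex.real_smul,
      map_smul, LinearIsometryEquiv.apply_symm_apply]
  set X : Set ℂ := {w : ℂ | ∃ s : ℝ, 0 ≤ s ∧ (w = s ∨ w = s * Complex.exp (β * Complex.I))} with hX
  have hXray : ψ '' X = ray y u ∪ ray y v := by
    ext z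
    constructor
    · rintro ⟨w, ⟨s, hs, rfl | rfl⟩, rfl⟩
      · exact Or.inl ⟨s, hs, hψu s⟩
      · exact Or.inr ⟨s, hs, by rw [hβd]; exact hψv s⟩
    · rintro (⟨s, hs, rfl⟩ | ⟨s, hs, rfl⟩)
      · exact ⟨_, ⟨s, hs, Or.inl rfl⟩, hψu s⟩
      · exact ⟨_, ⟨s, hs, Or.inr rfl⟩, by rw [hβd]; exact hψv s⟩
  have hball : ψ '' Metric.ball 0 r = Metric.ball y r := by
    ext z
    constructor
    · rintro ⟨w, hw, rfl⟩
      rw [Metric.mem_ball, hψn]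
      exact mem_ball_zero_iff.1 hw
    · intro hz
      obtain ⟨w, rfl⟩ := hψs z
      rw [Metric.mem_ball, hψn] at hz
      exact ⟨w, mem_ball_zero_iff.2 hz, rfl⟩
  have hcl : ∀ α γ : ℝ, α < γ → (∀ s : ℝ, 0 ≤ s → s < r → (s : ℂ) ∈ closure (sector r α γ)) →
      β ∈ Icc α γ → (ray y u ∪ ray y v) ∩ Metric.ball y r ⊆ closure (ψ '' sector r α γ) := by
    intro α γ hαγ h0 hβ'
    rw [← hXray, ← hball, ← image_inter hψi]
    refine (image_mono ?_).trans (image_closure_subset_closure_image hψc)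
    rintro w ⟨⟨s, hs, rfl | rfl⟩, hw⟩
    · refine h0 s hs ?_
      rwa [mem_ball_zero_iff, Complex.norm_of_nonneg hs] at hw
    · refine mem_closure_sector hαγ hβ' hs ?_
      rwa [mem_ball_zero_iff, norm_mul, Complex.norm_exp_ofReal_mul_I, mul_one,
        Complex.norm_of_nonneg hs] at hw
  refine ⟨ψ '' sector r 0 β, ψ '' sector r β (2 * Real.pi),
    (isPreconnected_sector _ _ _).image _ hψc.continuousOn,
    (isPreconnected_sector _ _ _).image _ hψc.continuousOn, ?_, ?_, ?_⟩
  · rw [← image_union, union_sector hβ, image_sdiff hψi, hXray, hball]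
  · refine hcl _ _ hβ.1 (fun s hs hsr => ?_) ⟨hβ.1.le, le_rfl⟩
    have := mem_closure_sector (θ := 0) hβ.1 ⟨le_rfl, hβ.1.le⟩ hs hsr
    simpa using this
  · refine hcl _ _ hβ.2 (fun s hs hsr => ?_) ⟨le_rfl, hβ.2.le⟩
    have := mem_closure_sector (θ := 2 * Real.pi) hβ.2 ⟨hβ.2.le, le_rfl⟩ hs hsr
    push_cast at this
    rwa [Complex.exp_two_pi_mul_I, mul_one] at this

theorem IsPolygonalArc.left_mem_closure {a b : Plane} {S : Set Plane} (h : IsPolygonalArc a b S) :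
    a ∈ closure (S \ {a, b}) := by
  obtain ⟨u, hu, r, hr, H⟩ := h.exists_eq_ray
  rw [Metric.mem_closure_iff]
  intro ε hε
  set s := min (min r ε) (Dist.dist a b) / 2 with hs
  have hpos : 0 < min (min r ε) (Dist.dist a b) := lt_min (lt_min hr hε) (dist_pos.2 h.ne)
  have h1 : min (min r ε) (Dist.dist a b) ≤ min r ε := min_le_left _ _
  have h2 : min r ε ≤ r := min_le_left _ _
  have h3 : min r ε ≤ ε := min_le_right _ _
  have h4 : min (min r ε) (Dist.dist a b) ≤ Dist.dist a b := min_le_right _ _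
  have hd : Dist.dist a (a + s • u) = s := by
    rw [_root_.dist_comm, dist_eq_norm, add_sub_cancel_left, norm_smul, hu, mul_one,
      Real.norm_of_nonneg (by linarith)]
  refine ⟨a + s • u, ⟨?_, ?_⟩, by linarith⟩
  · have : a + s • u ∈ ray a u ∩ Metric.ball a r :=
      ⟨⟨s, by linarith, rfl⟩, by rw [mem_ball', hd]; linarith⟩
    rw [← H] at this
    exact this.1
  · rintro (h | h)
    · rw [h, _root_.dist_self] at hd
      linarith
    · rw [h] at hd
      linarith

theorem IsPolygonalArc.subset_closure {a b : Plane} {S : Set Plane} (h : IsPolygonalArc a b S) :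
    S ⊆ closure (S \ {a, b}) := by
  intro z hz
  by_cases hza : z = a
  · rw [hza]; exact h.left_mem_closure
  by_cases hzb : z = b
  · rw [hzb, pair_comm]; exact h.symm.left_mem_closure
  · exact _root_.subset_closure ⟨hz, by rintro (h | h); exacts [hza h, hzb h]⟩

/-- Locally at an interior point of an arc, the complement of a set which looks there like the arc
has two sides. -/
theorem IsPolygonalArc.exists_sides {a b : Plane} {S K : Set Plane} (h : IsPolygonalArc a b S)
    (hSK : S ⊆ K) {y : Plane} (hy : y ∈ S \ {a, b}) {r : ℝ} (hr : 0 < r)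
    (hK : K ∩ Metric.ball y r ⊆ S) :
    ∃ ρ > 0, ∃ S₁ S₂ : Set Plane, IsPreconnected S₁ ∧ IsPreconnected S₂ ∧
      S₁ ∪ S₂ = Metric.ball y ρ \ K ∧ K ∩ Metric.ball y ρ ⊆ closure S₁ ∧
      K ∩ Metric.ball y ρ ⊆ closure S₂ := by
  obtain ⟨u, v, hu, hv, huv, s, hs, H⟩ := h.exists_eq_rays hy.1
    (fun h => hy.2 (Or.inl h)) (fun h => hy.2 (Or.inr h))
  obtain ⟨S₁, S₂, h1, h2, h3, h4, h5⟩ := exists_sectors y hu hv huv (min r s)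
  have key : (ray y u ∪ ray y v) ∩ Metric.ball y (min r s) = K ∩ Metric.ball y (min r s) := by
    have e : Metric.ball y (min r s) = Metric.ball y s ∩ Metric.ball y (min r s) :=
      (inter_eq_right.2 (ball_subset_ball (min_le_right _ _))).symm
    rw [e, ← inter_assoc, ← H, inter_assoc, ← e]
    refine Subset.antisymm (inter_subset_inter_left _ hSK) fun z hz => ⟨hK ⟨hz.1, ?_⟩, hz.2⟩
    exact ball_subset_ball (min_le_left _ _) hz.2
  refine ⟨min r s, lt_min hr hs, S₁, S₂, h1, h2, ?_, key ▸ h4, key ▸ h5⟩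
  rw [h3, ← sdiff_inter_self_eq_sdiff, key, sdiff_inter_self_eq_sdiff]

namespace IsRegion

variable {K W : Set Plane}

/-- A region with an interior point of an arc on its frontier has the whole arc there. -/
theorem subset_frontier (hW : IsRegion K W) {a b : Plane} {S : Set Plane}
    (h : IsPolygonalArc a b S) (hSK : S ⊆ K)
    (hloc : ∀ y ∈ S \ {a, b}, ∃ r > 0, K ∩ Metric.ball y r ⊆ S) {y : Plane}
    (hy : y ∈ S \ {a, b}) (hyW : y ∈ frontier W) : S ⊆ frontier W := by
  have key : ∀ y ∈ S \ {a, b}, ∃ r > 0, y ∈ closure W →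
      S ∩ Metric.ball y r ⊆ closure W := by
    intro y hy
    obtain ⟨r, hr, hrS⟩ := hloc y hy
    obtain ⟨ρ, hρ, S₁, S₂, h1, h2, h3, h4, h5⟩ := h.exists_sides hSK hy hr hrS
    refine ⟨ρ, hρ, fun hyW => ?_⟩
    obtain ⟨w, hw, hwW⟩ := mem_closure_iff.1 hyW _ isOpen_ball (Metric.mem_ball_self hρ)
    have hwS : w ∈ S₁ ∪ S₂ := by
      rw [h3]; exact ⟨hw, Set.disjoint_left.1 hW.disjoint hwW⟩
    have hdis : Disjoint (S₁ ∪ S₂) K := by rw [h3]; exact disjoint_sdiff_left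
    rw [disjoint_union_left] at hdis
    rcases hwS with hwS | hwS
    · exact (inter_subset_inter_left _ hSK).trans (h4.trans
        (closure_mono (hW.subset_of_isPreconnected h1 hdis.1 ⟨w, hwS, hwW⟩)))
    · exact (inter_subset_inter_left _ hSK).trans (h5.trans
        (closure_mono (hW.subset_of_isPreconnected h2 hdis.2 ⟨w, hwS, hwW⟩)))
  choose! r hr hrW using key
  -- The part of the open arc in `closure W` is relatively closed, and relatively open because each
  -- side accumulates at the whole arc nearby; the open arc is connected.
  have hsub : S \ {a, b} ⊆ closure W := by
    by_contra hcon
    rw [not_subset] at hcon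
    obtain ⟨x, hx, hxW⟩ := hcon
    obtain ⟨z, hz, hz1, hz2⟩ := h.isPreconnected_diff
      (⋃ y ∈ (S \ {a, b}) ∩ closure W, Metric.ball y (r y)) (closure W)ᶜ
      (isOpen_biUnion fun _ _ => isOpen_ball) isClosed_closure.isOpen_compl
      (fun z hz => by
        by_cases hzW : z ∈ closure W
        · exact Or.inl (mem_biUnion (show z ∈ (S \ {a, b}) ∩ closure W from ⟨hz, hzW⟩)
            (Metric.mem_ball_self (hr z hz)))
        · exact Or.inr hzW)
      ⟨y, hy, mem_biUnion (show y ∈ (S \ {a, b}) ∩ closure W from ⟨hy, hyW.1⟩)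
            (Metric.mem_ball_self (hr y hy))⟩
      ⟨x, hx, hxW⟩
    simp only [mem_iUnion] at hz1
    obtain ⟨y', hy', hz1⟩ := hz1
    exact hz2 (hrW y' hy'.1 hy'.2 ⟨hz.1, hz1⟩)
  intro z hz
  exact hW.mem_frontier_iff.2
    ⟨closure_minimal hsub isClosed_closure (h.subset_closure hz), hSK hz⟩

/-- At most two regions meet at an interior point of an arc. -/
theorem eq_of_mem_frontier {W₁ W₂ W₃ : Set Plane} (hW₁ : IsRegion K W₁) (hW₂ : IsRegion K W₂)
    (hW₃ : IsRegion K W₃) {a b : Plane} {S : Set Plane} (h : IsPolygonalArc a b S) (hSK : S ⊆ K)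
    {y : Plane} (hy : y ∈ S \ {a, b}) {r : ℝ} (hr : 0 < r) (hK : K ∩ Metric.ball y r ⊆ S)
    (h₁ : y ∈ frontier W₁) (h₂ : y ∈ frontier W₂) (h₃ : y ∈ frontier W₃) (h13 : W₁ ≠ W₃)
    (h23 : W₂ ≠ W₃) : W₁ = W₂ := by
  obtain ⟨ρ, hρ, S₁, S₂, h1, h2, h3, -, -⟩ := h.exists_sides hSK hy hr hK
  have hdis : Disjoint (S₁ ∪ S₂) K := by rw [h3]; exact disjoint_sdiff_left
  rw [disjoint_union_left] at hdis
  have key : ∀ W, IsRegion K W → y ∈ frontier W →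
      (S₁.Nonempty ∧ S₁ ⊆ W) ∨ (S₂.Nonempty ∧ S₂ ⊆ W) := by
    intro W hW hyW
    obtain ⟨w, hw, hwW⟩ := mem_closure_iff.1 hyW.1 _ isOpen_ball (Metric.mem_ball_self hρ)
    have hwS : w ∈ S₁ ∪ S₂ := by
      rw [h3]; exact ⟨hw, Set.disjoint_left.1 hW.disjoint hwW⟩
    rcases hwS with hwS | hwS
    · exact Or.inl ⟨⟨w, hwS⟩, hW.subset_of_isPreconnected h1 hdis.1 ⟨w, hwS, hwW⟩⟩
    · exact Or.inr ⟨⟨w, hwS⟩, hW.subset_of_isPreconnected h2 hdis.2 ⟨w, hwS, hwW⟩⟩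
  have same : ∀ {W W' C : Set Plane}, IsRegion K W → IsRegion K W' → C.Nonempty ∧ C ⊆ W →
      C.Nonempty ∧ C ⊆ W' → W = W' := fun hW hW' h h' =>
    hW.eq_of_inter_nonempty hW' (h.1.mono (subset_inter h.2 h'.2))
  -- Pigeonhole: three regions and two sides, and regions containing the same side coincide.
  rcases key _ hW₁ h₁ with k1 | k1 <;> rcases key _ hW₂ h₂ with k2 | k2 <;>
    rcases key _ hW₃ h₃ with k3 | k3
  all_goals first
    | exact same hW₁ hW₂ k1 k2
    | exact absurd (same hW₁ hW₃ k1 k3) h13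
    | exact absurd (same hW₂ hW₃ k2 k3) h23

end IsRegion

/-! ### Disjoint arcs inside a region: stars and matchings. -/

/-- Lets `IsRegion.subset_of_isPreconnected` be used with the frontier of `W` as the only barrier: a
connected set that meets `W` and avoids its frontier lies in `W`. -/
theorem isRegion_frontier {W : Set Plane} (ho : IsOpen W) (hc : IsPreconnected W)
    (hne : W.Nonempty) : IsRegion (frontier W) W :=
  ⟨ho, hc, hne, disjoint_frontier_iff_isOpen.2 ho |>.symm, Subset.rfl⟩

/-- The components meeting `U` need not be known to be finite in number: a point `w` of `U` close to
`z` sees `z`, so the component of `w` already has `z` on its frontier. -/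
theorem IsPolygonalSet.exists_isRegion {K U : Set Plane} (hK : IsPolygonalSet K)
    (hUK : Disjoint U K) {z : Plane} (hz : z ∈ K) (hzU : z ∈ closure U) :
    ∃ w ∈ U, ∃ W, IsRegion K W ∧ w ∈ W ∧ z ∈ frontier W := by
  obtain ⟨r, hr, H⟩ := hK.exists_disjoint_segment z
  obtain ⟨w, hw, hwU⟩ := mem_closure_iff.1 hzU _ isOpen_ball (Metric.mem_ball_self hr)
  have hwK : w ∉ K := Set.disjoint_left.1 hUK hwU
  have hne : w ≠ z := fun h => hwK (h ▸ hz)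
  have hW := IsRegion.connectedComponentIn hK.isClosed hwK
  have hwW := mem_connectedComponentIn (show w ∈ Kᶜ from hwK)
  refine ⟨w, hwU, _, hW, hwW, hW.mem_frontier_iff.2 ⟨?_, hz⟩⟩
  have hsub := hW.subset_of_isPreconnected
    (IsPolygonalArc.segment w z hne).isPreconnected_diff_right (H w hw hwK)
    ⟨w, ⟨left_mem_segment ℝ w z, hne⟩, hwW⟩
  refine closure_mono hsub (closure_mono (sdiff_subset_sdiff_right (by simp : {z} ⊆ ({z, w} : Set _)))
    ?_)
  exact (IsPolygonalArc.segment w z hne).symm.left_mem_closure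

/-- Inside a region, a point can be joined to finitely many points of the frontier by arcs which
are disjoint apart from their common origin. -/
theorem IsRegion.exists_star {K W : Set Plane} (hK : IsPolygonalSet K) (hW : IsRegion K W)
    {p : Plane} (hp : p ∈ W) {T : Set Plane} (hT : T.Finite) (hTW : T ⊆ frontier W) :
    ∃ A : Plane → Set Plane, ∀ t ∈ T, IsPolygonalArc p t (A t) ∧ A t ⊆ insert t W ∧
      ∀ t' ∈ T, t ≠ t' → A t ∩ A t' ⊆ {p} := by
  classical
  have hWK : ∀ z ∈ W, z ∉ K := fun z hz => Set.disjoint_left.1 hW.disjoint hz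
  induction T, hT using Set.Finite.induction_on with
  | empty => exact ⟨fun _ => ∅, by simp⟩
  | @insert t T htT hT ih =>
    obtain ⟨A, hA⟩ := ih ((subset_insert _ _).trans hTW)
    have hTK : ∀ s ∈ T, s ∈ K := fun s hs => hW.frontier_subset (hTW (mem_insert_of_mem _ hs))
    have ht : t ∈ frontier W := hTW (mem_insert _ _)
    have htK : t ∈ K := hW.frontier_subset ht
    have htW : t ∉ W := fun h => hWK t h htK
    have hps : ∀ s ∈ K, p ≠ s := fun s hs h => hWK p hp (h ▸ hs)
    -- The part of the star already drawn. The next arc runs in a component `W'` of the complement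
    -- of `K ∪ Z` that lies in `W` and has `t` on its frontier.
    set Z : Set Plane := {p} ∪ ⋃ s ∈ T, A s with hZ
    have hZp : IsPolygonalSet Z := (IsPolygonalSet.singleton p).union
      (.biUnion hT fun s hs => (hA s hs).1.isPolygonalSet)
    have hZsub : ∀ z ∈ Z, z ∉ T → z ∈ W := by
      rintro z (hz | hz) hzT
      · rw [mem_singleton_iff.1 hz]; exact hp
      · simp only [mem_iUnion] at hz
        obtain ⟨s, hs, hz⟩ := hz
        exact ((hA s hs).2.1 hz).resolve_left fun h => hzT (h ▸ hs)
    have htZ : t ∉ Z := fun h => htW (hZsub t h htT)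
    have hK' := hK.union hZp
    have hcl : t ∈ closure (W \ Z) := by
      rw [_root_.mem_closure_iff]
      intro O hO htO
      obtain ⟨z, hz, hzW⟩ := mem_closure_iff.1 ht.1 _
        (hO.inter hZp.isClosed.isOpen_compl) ⟨htO, htZ⟩
      exact ⟨z, hz.1, hzW, hz.2⟩
    obtain ⟨w, hw, W', hW', hwW', htW'⟩ := hK'.exists_isRegion
      (disjoint_union_right.2 ⟨hW.disjoint.mono_left sdiff_subset, disjoint_sdiff_left⟩)
      (Or.inl htK) hcl
    have hdis := disjoint_union_right.1 hW'.disjoint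
    have hsub : W' ⊆ W := hW.subset_of_isPreconnected hW'.isPreconnected hdis.1 ⟨w, hwW', hw.1⟩
    -- The drawn star does not cut `t` off from `p`. If the frontier of `W'` missed `W`, then `W ⊆
    -- W'` would contain `p`, which is in `Z`. So it meets `W` in a point of `Z`; unless this is `p`
    -- itself, it is interior to some arc `A s`, and then all of `A s`, including `p`, lies on the
    -- frontier.
    have hpW' : p ∈ frontier W' := by
      have hfr : ¬ Disjoint W (frontier W') := by
        intro hd
        have := (isRegion_frontier hW'.isOpen hW'.isPreconnected hW'.nonempty
          ).subset_of_isPreconnected hW.isPreconnected hd ⟨w, hw.1, hwW'⟩ hp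
        exact Set.disjoint_left.1 hdis.2 this (Or.inl rfl)
      rw [Set.not_disjoint_iff] at hfr
      obtain ⟨z, hzW, hz⟩ := hfr
      rcases hW'.frontier_subset hz with hzK | hzp | hzA
      · exact absurd hzK (hWK z hzW)
      · rw [← mem_singleton_iff.1 hzp]; exact hz
      · simp only [mem_iUnion] at hzA
        obtain ⟨s, hs, hzs⟩ := hzA
        by_cases hzp : z = p
        · rw [← hzp]; exact hz
        refine hW'.subset_frontier (hA s hs).1
          ((subset_biUnion_of_mem (u := A) hs).trans
            (subset_union_right.trans subset_union_right)) ?_ (y := z) ⟨hzs, ?_⟩ hz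
          (hA s hs).1.left_mem
        · intro y hy
          have hyW : y ∈ W := ((hA s hs).2.1 hy.1).resolve_left fun h => hy.2 (Or.inr h)
          have hL : IsPolygonalSet (K ∪ ({p} ∪ ⋃ s' ∈ T \ {s}, A s')) :=
            hK.union ((IsPolygonalSet.singleton p).union
              (.biUnion (hT.subset sdiff_subset) fun s hs => (hA s hs.1).1.isPolygonalSet))
          have hyL : y ∈ (K ∪ ({p} ∪ ⋃ s' ∈ T \ {s}, A s'))ᶜ := by
            rintro (h | h | h)
            · exact hWK y hyW h
            · exact hy.2 (Or.inl h)
            · simp only [mem_iUnion] at h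
              obtain ⟨s', hs', h⟩ := h
              exact hy.2 (Or.inl ((hA s hs).2.2 s' hs'.1 (Ne.symm hs'.2) ⟨hy.1, h⟩))
          obtain ⟨r, hr, hrL⟩ := Metric.isOpen_iff.1 hL.isClosed.isOpen_compl y hyL
          refine ⟨r, hr, ?_⟩
          rintro x ⟨hx, hxr⟩
          have hxL := hrL hxr
          by_contra hxs
          apply hxL
          rcases hx with h | h | h
          · exact Or.inl h
          · exact Or.inr (Or.inl h)
          · simp only [mem_iUnion] at h
            obtain ⟨s', hs', h⟩ := h
            refine Or.inr (Or.inr (mem_biUnion (show s' ∈ T \ {s} from ⟨hs', ?_⟩) h))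
            rintro rfl
            exact hxs h
        · rintro (h | h)
          · exact hzp h
          · exact hWK z hzW (mem_singleton_iff.1 h ▸ hTK s hs)
    obtain ⟨R, hR, hRarc⟩ := hW'.exists_arc hK' hpW' htW' (hps t htK)
    have hRW : R ⊆ insert t W := by
      intro z hz
      rcases hR hz with rfl | rfl | h
      · exact Or.inr hp
      · exact Or.inl rfl
      · exact Or.inr (hsub h)
    have hRA : ∀ s ∈ T, R ∩ A s ⊆ {p} := by
      rintro s hs z ⟨hz, hzs⟩
      have hzZ : z ∈ Z := Or.inr (mem_biUnion hs hzs)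
      rcases hR hz with rfl | rfl | h
      · rfl
      · exact absurd hzZ htZ
      · exact absurd hzZ (Set.disjoint_left.1 hdis.2 h)
    refine ⟨Function.update A t R, ?_⟩
    have hup : ∀ s ∈ T, Function.update A t R s = A s := fun s hs =>
      Function.update_of_ne (by rintro rfl; exact htT hs) _ _
    rintro s (rfl | hs)
    · rw [Function.update_self]
      refine ⟨hRarc, hRW, ?_⟩
      rintro s' (rfl | hs') hne
      · exact absurd rfl hne
      · rw [hup s' hs']; exact hRA s' hs'
    · rw [hup s hs]
      refine ⟨(hA s hs).1, (hA s hs).2.1, ?_⟩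
      rintro s' (rfl | hs') hne
      · rw [Function.update_self, inter_comm]; exact hRA s hs
      · rw [hup s' hs']; exact (hA s hs).2.2 s' hs' hne

/-- Strict convexity of the disc: the interior of a chord lies in the open disc. -/
theorem eq_or_eq_of_mem_segment_of_mem_sphere {q a b c : Plane} {r : ℝ} (ha : a ∈ sphere q r)
    (hb : b ∈ sphere q r) (hc : c ∈ sphere q r) (h : c ∈ [a -[ℝ] b]) : c = a ∨ c = b := by
  by_contra hcon
  push Not at hcon
  have hab : a ≠ b := by
    rintro rfl
    rw [segment_same] at h
    exact hcon.1 h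
  have h1 : c ∈ openSegment ℝ a b := mem_openSegment_of_ne_left_right hcon.1.symm hcon.2.symm h
  have h2 := openSegment_subset_ball_of_ne (sphere_subset_closedBall ha)
    (sphere_subset_closedBall hb) hab h1
  exact absurd (mem_sphere.1 hc) (Metric.mem_ball.1 h2).ne

/-- Two chords from `a` with a second common point have the same direction, so one contains the far
end of the other, and strict convexity identifies the ends. -/
theorem eq_of_mem_segment_of_mem_sphere {q a b c z : Plane} {r : ℝ} (ha : a ∈ sphere q r)
    (hb : b ∈ sphere q r) (hc : c ∈ sphere q r) (hab : a ≠ b) (hac : a ≠ c)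
    (hzb : z ∈ [a -[ℝ] b]) (hzc : z ∈ [a -[ℝ] c]) (hz : z ≠ a) : b = c := by
  have key : ∀ {b c : Plane} {s t : ℝ}, b ∈ sphere q r → c ∈ sphere q r → a ≠ c → 0 ≤ s →
      0 < t → s ≤ t → a + s • (b - a) = a + t • (c - a) → c = b := by
    intro b c s t hb hc hac hs ht hst h
    refine (eq_or_eq_of_mem_segment_of_mem_sphere ha hb hc ?_).resolve_left hac.symm
    rw [segment_eq_image']
    refine ⟨s / t, ⟨div_nonneg hs ht.le, (div_le_one ht).2 hst⟩, ?_⟩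
    simp only
    rw [div_eq_inv_mul, mul_smul, add_left_cancel h, smul_smul, inv_mul_cancel₀ ht.ne', one_smul,
      add_sub_cancel]
  rw [segment_eq_image'] at hzb hzc
  obtain ⟨s, hs, h1⟩ := hzb
  obtain ⟨t, ht, h2⟩ := hzc
  have hs0 : 0 < s := hs.1.lt_of_ne' (by rintro rfl; simp at h1; exact hz h1.symm)
  have ht0 : 0 < t := ht.1.lt_of_ne' (by rintro rfl; simp at h2; exact hz h2.symm)
  rcases le_total s t with hst | hst
  · exact (key hb hc hac hs.1 ht0 hst (h1.trans h2.symm)).symm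
  · exact key hc hb hab ht.1 hs0 hst (h2.trans h1.symm)

/-- Points on a circle, half of them red and half of them blue, can be matched by disjoint chords:
a matching of minimal total length does it. -/
theorem exists_perm_disjoint_chords {ι : Type*} [Finite ι] {q : Plane} {r : ℝ} {x y : ι → Plane}
    (hx : ∀ i, x i ∈ sphere q r) (hy : ∀ i, y i ∈ sphere q r)
    (hinj : Function.Injective (Sum.elim x y)) :
    ∃ σ : Equiv.Perm ι, ∀ i j, i ≠ j →
      Disjoint [x i -[ℝ] y (σ i)] [x j -[ℝ] y (σ j)] := by
  classical
  cases nonempty_fintype ι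
  rw [Sum.elim_injective] at hinj
  obtain ⟨hxi, hyi, hxy⟩ := hinj
  obtain ⟨σ, hσ⟩ := Finite.exists_min fun σ : Equiv.Perm ι => ∑ i, Dist.dist (x i) (y (σ i))
  refine ⟨σ, fun i j hij => Set.disjoint_left.2 fun z hzi hzj => ?_⟩
  -- Exchanging the partners of two meeting chords shortens them, by the triangle inequality through
  -- `z`. Equality would put `z` on the chord from `x i` to `y (σ j)` too, forcing `σ i = σ j`.
  have hlt : Dist.dist (x i) (y (σ j)) + Dist.dist (x j) (y (σ i)) <
      Dist.dist (x i) (y (σ i)) + Dist.dist (x j) (y (σ j)) := by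
    by_contra hcon
    push Not at hcon
    have e1 := dist_add_dist_of_mem_segment hzi
    have e2 := dist_add_dist_of_mem_segment hzj
    have e3 := dist_triangle (x i) z (y (σ j))
    have e4 := dist_triangle (x j) z (y (σ i))
    have h5 : z ∈ [x i -[ℝ] y (σ j)] :=
      mem_segment_iff_wbtw.2 (dist_add_dist_eq_iff.1 (by linarith))
    have hzx : z ≠ x i := by
      rintro rfl
      rcases eq_or_eq_of_mem_segment_of_mem_sphere (hx j) (hy _) (hx i) hzj with h | h
      · exact hij (hxi h)
      · exact hxy _ _ h
    have := eq_of_mem_segment_of_mem_sphere (hx i) (hy _) (hy _) (hxy _ _) (hxy _ _) hzi h5 hzx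
    exact hij (σ.injective (hyi this))
  refine absurd (hσ (σ * Equiv.swap i j)) (not_le.2 ?_)
  have hj : j ∈ Finset.univ.erase i := Finset.mem_erase.2 ⟨hij.symm, Finset.mem_univ _⟩
  rw [← Finset.add_sum_erase _ _ (Finset.mem_univ i), ← Finset.add_sum_erase _ _ hj,
    ← Finset.add_sum_erase _ (fun k => Dist.dist (x k) (y (σ k))) (Finset.mem_univ i),
    ← Finset.add_sum_erase _ (fun k => Dist.dist (x k) (y (σ k))) hj, ← add_assoc, ← add_assoc]
  have hrest : ∑ k ∈ (Finset.univ.erase i).erase j,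
      Dist.dist (x k) (y ((σ * Equiv.swap i j) k)) =
      ∑ k ∈ (Finset.univ.erase i).erase j, Dist.dist (x k) (y (σ k)) := by
    refine Finset.sum_congr rfl fun k hk => ?_
    simp only [Finset.mem_erase] at hk
    rw [Equiv.Perm.mul_apply, Equiv.swap_apply_of_ne_of_ne hk.2.1 hk.1]
  rw [hrest]
  simpa using hlt

/-- Inside a region, two disjoint sets of frontier points of equal size can be matched by disjoint
arcs. -/
theorem IsRegion.exists_matching {K W : Set Plane} (hK : IsPolygonalSet K) (hW : IsRegion K W)
    {ι : Type*} [Finite ι] {x y : ι → Plane} (hx : ∀ i, x i ∈ frontier W)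
    (hy : ∀ i, y i ∈ frontier W) (hinj : Function.Injective (Sum.elim x y)) :
    ∃ (σ : Equiv.Perm ι) (R : ι → Set Plane), ∀ i, IsPolygonalArc (x i) (y (σ i)) (R i) ∧
      R i ⊆ insert (x i) (insert (y (σ i)) W) ∧ ∀ j, i ≠ j → Disjoint (R i) (R j) := by
  obtain ⟨q, hq⟩ := hW.nonempty
  obtain ⟨A, hA⟩ := hW.exists_star hK hq (T := range (Sum.elim x y)) (finite_range _) (by
    rintro _ ⟨i | i, rfl⟩
    exacts [hx i, hy i])
  set P := Sum.elim x y with hP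
  obtain ⟨r₁, hr₁, hr₁W⟩ := Metric.isOpen_iff.1 hW.isOpen q hq
  have htrim := fun k => (hA (P k) ⟨k, rfl⟩).1.exists_trim
  choose u hu r₀ hr₀ H using htrim
  obtain ⟨r, ⟨hr, hrW⟩, hrr⟩ : ∃ r, (0 < r ∧ r < r₁) ∧ ∀ k, r < r₀ k := by
    have h1 : ∀ᶠ r in 𝓝[>] (0 : ℝ), 0 < r ∧ r < r₁ := Ioo_mem_nhdsGT hr₁
    have h2 : ∀ᶠ r in 𝓝[>] (0 : ℝ), ∀ k, r < r₀ k :=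
      eventually_all.2 fun k => mem_of_superset (Ioo_mem_nhdsGT (hr₀ k)) fun _ h => h.2
    exact (h1.and h2).exists
  choose B hB hAB hBr using fun k => H k r hr (hrr k)
  have hballW : closedBall q r ⊆ W := (closedBall_subset_ball hrW).trans hr₁W
  -- The points where the star crosses a small circle. The outer pieces `B k` are pairwise disjoint
  -- and meet the disc only in `c k`, so inside the disc the star can be replaced by disjoint
  -- chords.
  set c := fun k => q + r • u k with hc
  have hcs : ∀ k, c k ∈ sphere q r := fun k => by
    rw [mem_sphere, dist_eq_norm, hc, add_sub_cancel_left, norm_smul, hu, mul_one,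
      Real.norm_of_nonneg hr.le]
  have hcq : ∀ k, c k ≠ q := fun k h => by
    have := hcs k
    rw [h, mem_sphere, _root_.dist_self] at this
    exact hr.ne this
  have hBA : ∀ k, B k ⊆ A (P k) := fun k => by rw [hAB k]; exact subset_union_right
  have hBB : ∀ k l, k ≠ l → Disjoint (B k) (B l) := fun k l hkl =>
    Set.disjoint_left.2 fun z hzk hzl => by
      have hzq : z = q := (hA (P k) ⟨k, rfl⟩).2.2 (P l) ⟨l, rfl⟩ (hinj.ne hkl)
        ⟨hBA k hzk, hBA l hzl⟩
      subst hzq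
      exact hcq k (hBr k ⟨hzk, mem_closedBall_self hr.le⟩).symm
  have hci : Function.Injective c := by
    intro k l h
    by_contra hkl
    exact Set.disjoint_left.1 (hBB k l hkl) (hB k).left_mem
      (show c k ∈ B l from h ▸ (hB l).left_mem)
  obtain ⟨σ, hσ⟩ := exists_perm_disjoint_chords (x := fun i => c (.inl i))
    (y := fun i => c (.inr i)) (fun i => hcs _) (fun i => hcs _)
    (by convert hci using 1; ext (k | k) <;> rfl)
  have hchord : ∀ i, [c (.inl i) -[ℝ] c (.inr (σ i))] ⊆ closedBall q r := fun i =>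
    (convex_closedBall q r).segment_subset (sphere_subset_closedBall (hcs _))
      (sphere_subset_closedBall (hcs _))
  have hBc : ∀ k i, B k ∩ [c (.inl i) -[ℝ] c (.inr (σ i))] ⊆ {c k} := fun k i z hz =>
    hBr k ⟨hz.1, hchord i hz.2⟩
  have hBc' : ∀ k i, k ≠ .inl i → k ≠ .inr (σ i) →
      Disjoint (B k) [c (.inl i) -[ℝ] c (.inr (σ i))] := fun k i h1 h2 =>
    Set.disjoint_left.2 fun z hzk hz => by
      have hzc : z = c k := hBc k i ⟨hzk, hz⟩
      subst hzc
      rcases eq_or_eq_of_mem_segment_of_mem_sphere (hcs _) (hcs _) (hcs k) hz with h | h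
      · exact h1 (hci h)
      · exact h2 (hci h)
  refine ⟨σ, fun i => B (.inl i) ∪ ([c (.inl i) -[ℝ] c (.inr (σ i))] ∪ B (.inr (σ i))),
    fun i => ⟨?_, ?_, fun j hij => ?_⟩⟩
  · have hne : c (.inl i) ≠ c (.inr (σ i)) := hci.ne (by simp)
    have h1 := (IsPolygonalArc.segment _ _ hne).trans (hB (.inr (σ i)))
      (by rw [inter_comm]; exact hBc _ _)
    refine (hB (.inl i)).symm.trans h1 ?_
    rintro z ⟨hz, hz' | hz'⟩
    · exact hBc _ _ ⟨hz, hz'⟩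
    · exact absurd hz' (Set.disjoint_left.1 (hBB _ _ (by simp)) hz)
  · refine union_subset ?_ (union_subset ?_ ?_)
    · exact (hBA _).trans ((hA _ ⟨_, rfl⟩).2.1.trans
        (insert_subset_insert (subset_insert _ _)))
    · exact (hchord i).trans (hballW.trans ((subset_insert _ _).trans (subset_insert _ _)))
    · exact (hBA _).trans ((hA _ ⟨_, rfl⟩).2.1.trans (subset_insert _ _))
  · have hσij : σ i ≠ σ j := σ.injective.ne hij
    simp only [disjoint_union_left, disjoint_union_right]
    refine ⟨⟨hBB _ _ (by simpa), ?_, ?_⟩, ⟨?_, hσ i j hij, ?_⟩, ?_, ?_, hBB _ _ (by simpa)⟩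
    · exact (hBc' _ _ (by simpa using hij.symm) (by simp)).symm
    · exact hBB _ _ (by simp)
    · exact hBc' _ _ (by simpa) (by simp)
    · exact hBc' _ _ (by simp) (by simpa)
    · exact hBB _ _ (by simp)
    · exact (hBc' _ _ (by simp) (by simpa using hij.symm)).symm

/-! ### The unbounded component. -/

theorem isPreconnected_compl_closedBall {R : ℝ} (hR : 0 ≤ R) :
    IsPreconnected (closedBall (0 : Plane) R)ᶜ := by
  have hrank : 1 < Module.rank ℝ Plane := by
    rw [← Module.finrank_eq_rank, finrank_euclideanSpace, Fintype.card_fin]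
    norm_num
  have himg : (closedBall (0 : Plane) R)ᶜ =
      (fun x : ℝ × Plane => x.1 • x.2) '' (Ioi R ×ˢ sphere (0 : Plane) 1) := by
    ext z
    simp only [mem_compl_iff, mem_closedBall_zero_iff, not_le, mem_image, mem_prod, mem_Ioi,
      mem_sphere_zero_iff_norm, Prod.exists]
    constructor
    · intro hz
      have hpos : 0 < ‖z‖ := hR.trans_lt hz
      refine ⟨‖z‖, ‖z‖⁻¹ • z, ⟨hz, ?_⟩, ?_⟩
      · rw [norm_smul, norm_inv, norm_norm, inv_mul_cancel₀ hpos.ne']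
      · rw [smul_smul, mul_inv_cancel₀ hpos.ne', one_smul]
    · rintro ⟨s, u, ⟨hs, hu⟩, rfl⟩
      rw [norm_smul, hu, mul_one]
      exact hs.trans_le (Real.le_norm_self s)
  rw [himg]
  exact (isPreconnected_Ioi.prod (isPreconnected_sphere hrank 0 1)).image _ (by fun_prop)

/-- The complement of a bounded set has exactly one unbounded component. -/
theorem isRegion_unbounded {K : Set Plane} (hK : IsCompact K) :
    IsRegion K {p | p ∈ Kᶜ ∧ ¬ Bornology.IsBounded (connectedComponentIn Kᶜ p)} := by
  obtain ⟨R, hR, hKR⟩ := hK.isBounded.subset_closedBall_lt 0 0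
  set C : Set Plane := (closedBall (0 : Plane) R)ᶜ with hC
  have hCb : ∀ s : Set Plane, C ⊆ s → ¬ Bornology.IsBounded s := fun s hs hb => by
    have := (hb.subset hs).union (isBounded_closedBall (x := (0 : Plane)) (r := R))
    rw [hC, compl_union_self] at this
    exact NormedSpace.unbounded_univ ℝ Plane this
  have hCne : C.Nonempty := by
    rw [nonempty_iff_ne_empty]
    intro h
    exact hCb ∅ h.subset Bornology.isBounded_empty
  obtain ⟨c, hc⟩ := hCne
  have hCK : Disjoint C K := disjoint_compl_left.mono_right hKR
  have hcK : c ∉ K := Set.disjoint_left.1 hCK hc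
  have hF := IsRegion.connectedComponentIn hK.isClosed hcK
  have hCF := hF.subset_of_isPreconnected (isPreconnected_compl_closedBall hR.le) hCK
    ⟨c, hc, mem_connectedComponentIn (show c ∈ Kᶜ from hcK)⟩
  have heq : {p | p ∈ Kᶜ ∧ ¬ Bornology.IsBounded (connectedComponentIn Kᶜ p)} =
      connectedComponentIn Kᶜ c := by
    ext p
    constructor
    · rintro ⟨hp, hpb⟩
      have hW := IsRegion.connectedComponentIn hK.isClosed hp
      -- An unbounded component leaves the ball containing `K`, and outside that ball there is only
      -- one component.
      obtain ⟨x, hx, hxC⟩ : ∃ x ∈ connectedComponentIn Kᶜ p, x ∈ C := by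
        by_contra hcon
        push Not at hcon
        exact hpb (isBounded_closedBall.subset fun x hx => not_not.1 (hcon x hx))
      rw [← hW.eq_of_inter_nonempty hF ⟨x, hx, hCF hxC⟩]
      exact mem_connectedComponentIn hp
    · intro hp
      refine ⟨Set.disjoint_left.1 hF.disjoint hp, ?_⟩
      rw [← hF.eq_connectedComponentIn hK.isClosed hp]
      exact hCb _ hCF
  rw [heq]
  exact hF

theorem unbounded_mono {K K' : Set Plane} (h : K' ⊆ K) :
    {p | p ∈ Kᶜ ∧ ¬ Bornology.IsBounded (connectedComponentIn Kᶜ p)} ⊆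
      {p | p ∈ K'ᶜ ∧ ¬ Bornology.IsBounded (connectedComponentIn K'ᶜ p)} := fun p hp =>
  ⟨fun hpK => hp.1 (h hpK), fun hb =>
    hp.2 (hb.subset (connectedComponentIn_mono p (compl_subset_compl.2 h)))⟩

/-! ### Faces of plane drawings and of 2-outerplane drawings. -/

namespace Drawing

variable {V : Type*} {G : SimpleGraph V} (D : Drawing G)

theorem exists_isPolygonalArc {e : Sym2 V} (he : e ∈ G.edgeSet) :
    ∃ u v, e = s(u, v) ∧ IsPolygonalArc (D.pos u) (D.pos v) (D.arc e) := by
  induction e using Sym2.ind with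
  | _ u v => exact ⟨u, v, rfl, D.isArc u v he⟩

theorem pos_mem_arc {e : Sym2 V} (he : e ∈ G.edgeSet) {v : V} (hv : v ∈ e) :
    D.pos v ∈ D.arc e := by
  obtain ⟨a, b, rfl, h⟩ := D.exists_isPolygonalArc he
  rcases Sym2.mem_iff.1 hv with rfl | rfl
  · exact h.left_mem
  · exact h.right_mem

theorem arc_subset_support {e : Sym2 V} (he : e ∈ G.edgeSet) : D.arc e ⊆ D.support :=
  (subset_biUnion_of_mem (u := D.arc) he).trans subset_union_right

theorem pos_mem_support (v : V) : D.pos v ∈ D.support := Or.inl ⟨v, rfl⟩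

theorem isPolygonalSet_biUnion [Finite V] (s : Set (Sym2 V)) (hs : s ⊆ G.edgeSet) :
    IsPolygonalSet (range D.pos ∪ ⋃ e ∈ s, D.arc e) := by
  refine IsPolygonalSet.union ?_ (.biUnion (toFinite s) fun e he => ?_)
  · rw [← biUnion_of_singleton (range D.pos)]
    exact .biUnion (finite_range _) fun x _ => .singleton x
  · obtain ⟨u, v, -, h⟩ := D.exists_isPolygonalArc (hs he)
    exact h.isPolygonalSet

theorem isPolygonalSet_support [Finite V] : IsPolygonalSet D.support :=
  D.isPolygonalSet_biUnion _ Subset.rfl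

theorem isRegion_outerFace [Finite V] : IsRegion D.support D.outerFace :=
  isRegion_unbounded D.isPolygonalSet_support.isCompact

variable {D}

theorem IsFace.isRegion [Finite V] {f : Set Plane} (hf : D.IsFace f) : IsRegion D.support f := by
  obtain ⟨p, hp, rfl⟩ := hf
  exact .connectedComponentIn D.isPolygonalSet_support.isClosed hp

theorem IsFace.of_isRegion [Finite V] {f : Set Plane} (hf : IsRegion D.support f) : D.IsFace f := by
  obtain ⟨p, hp⟩ := hf.nonempty
  exact ⟨p, Set.disjoint_left.1 hf.disjoint hp,
    hf.eq_connectedComponentIn D.isPolygonalSet_support.isClosed hp⟩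

/-- The vertices and the other edges form a closed set missing `y`. This is the local hypothesis
under which arcs have two sides. -/
theorem IsPlane.exists_ball [Finite V] (hD : D.IsPlane) {e : Sym2 V} (he : e ∈ G.edgeSet)
    {y : Plane} (hy : y ∈ D.arc e) (hyV : y ∉ range D.pos) :
    ∃ r > 0, D.support ∩ Metric.ball y r ⊆ D.arc e := by
  have hL := D.isPolygonalSet_biUnion (G.edgeSet \ {e}) sdiff_subset
  have hyL : y ∈ (range D.pos ∪ ⋃ e' ∈ G.edgeSet \ {e}, D.arc e')ᶜ := by
    rintro (h | h)
    · exact hyV h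
    · simp only [mem_iUnion] at h
      obtain ⟨e', he', h⟩ := h
      exact hyV (hD e he e' he'.1 (Ne.symm he'.2) ⟨hy, h⟩)
  obtain ⟨r, hr, H⟩ := Metric.isOpen_iff.1 hL.isClosed.isOpen_compl y hyL
  refine ⟨r, hr, ?_⟩
  rintro z ⟨hz | hz, hzr⟩
  · exact absurd (Or.inl hz) (H hzr)
  · simp only [mem_iUnion] at hz
    obtain ⟨e', he', hz⟩ := hz
    by_cases h : e' = e
    · exact h ▸ hz
    · exact absurd (Or.inr (mem_biUnion (show e' ∈ G.edgeSet \ {e} from ⟨he', h⟩) hz)) (H hzr)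

theorem IsPlane.arc_subset_frontier [Finite V] (hD : D.IsPlane) {W : Set Plane}
    (hW : IsRegion D.support W) {e : Sym2 V} (he : e ∈ G.edgeSet)
    {y : Plane} (hy : y ∈ D.arc e) (hyV : y ∉ range D.pos) (hyW : y ∈ frontier W) :
    D.arc e ⊆ frontier W := by
  obtain ⟨a, b, rfl, h⟩ := D.exists_isPolygonalArc he
  refine hW.subset_frontier h (D.arc_subset_support he) (fun z hz => ?_) (y := y) ⟨hy, ?_⟩ hyW
  · refine hD.exists_ball he hz.1 ?_
    rintro ⟨w, rfl⟩
    rcases Sym2.mem_iff.1 (D.mem_of_pos_mem _ he w hz.1) with rfl | rfl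
    · exact hz.2 (Or.inl rfl)
    · exact hz.2 (Or.inr rfl)
  · rintro (rfl | rfl) <;> exact hyV ⟨_, rfl⟩

theorem IsPlane.eq_of_mem_frontier [Finite V] (hD : D.IsPlane) {W₁ W₂ W₃ : Set Plane}
    (hW₁ : IsRegion D.support W₁) (hW₂ : IsRegion D.support W₂) (hW₃ : IsRegion D.support W₃)
    {e : Sym2 V} (he : e ∈ G.edgeSet) {y : Plane} (hy : y ∈ D.arc e) (hyV : y ∉ range D.pos)
    (h₁ : y ∈ frontier W₁) (h₂ : y ∈ frontier W₂) (h₃ : y ∈ frontier W₃) (h13 : W₁ ≠ W₃)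
    (h23 : W₂ ≠ W₃) : W₁ = W₂ := by
  obtain ⟨r, hr, hball⟩ := hD.exists_ball he hy hyV
  obtain ⟨a, b, rfl, h⟩ := D.exists_isPolygonalArc he
  refine hW₁.eq_of_mem_frontier hW₂ hW₃ h (D.arc_subset_support he) ⟨hy, ?_⟩ hr hball h₁ h₂ h₃
    h13 h23
  rintro (rfl | rfl) <;> exact hyV ⟨_, rfl⟩

variable (D) in
theorem exists_mem_arc {e : Sym2 V} (he : e ∈ G.edgeSet) : ∃ y ∈ D.arc e, y ∉ range D.pos := by
  obtain ⟨a, b, rfl, h⟩ := D.exists_isPolygonalArc he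
  obtain ⟨y, hy⟩ := closure_nonempty_iff.1 ⟨_, h.left_mem_closure⟩
  refine ⟨y, hy.1, ?_⟩
  rintro ⟨w, rfl⟩
  rcases Sym2.mem_iff.1 (D.mem_of_pos_mem _ he w hy.1) with rfl | rfl
  · exact hy.2 (Or.inl rfl)
  · exact hy.2 (Or.inr rfl)

theorem IsPlane.eq_of_mem_arc (hD : D.IsPlane) {e e' : Sym2 V} (he : e ∈ G.edgeSet)
    (he' : e' ∈ G.edgeSet) {y : Plane} (hy : y ∈ D.arc e) (hy' : y ∈ D.arc e')
    (hyV : y ∉ range D.pos) : e = e' := by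
  by_contra h
  exact hyV (hD e he e' he' h ⟨hy, hy'⟩)

theorem faceEdges_subset {f : Set Plane} {e : Sym2 V} (he : e ∈ D.faceEdges f) {v : V}
    (hv : v ∈ e) : v ∈ D.faceVerts f :=
  he.2 (D.pos_mem_arc he.1 hv)

theorem IsEdgeExposed.isVertexExposed {f : Set Plane} (hf : D.IsEdgeExposed f) :
    D.IsVertexExposed f := by
  obtain ⟨h1, h2, e, he, he'⟩ := hf
  obtain ⟨u, v, rfl, -⟩ := D.exists_isPolygonalArc he.1
  exact ⟨h1, h2, u, faceEdges_subset he (Sym2.mem_mk_left u v),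
    faceEdges_subset he' (Sym2.mem_mk_left u v)⟩

theorem support_induce_subset (s : Set V) : (D.induce s).support ⊆ D.support := by
  rintro z (⟨v, rfl⟩ | hz)
  · exact D.pos_mem_support v.1
  · simp only [mem_iUnion] at hz
    obtain ⟨e, he, hz⟩ := hz
    induction e using Sym2.ind with
    | _ u v => exact D.arc_subset_support (e := s(u.1, v.1)) he hz

/-- In a 2-outerplane drawing every vertex which is not on the outer face lies on a face sharing a
vertex with the outer face. -/
theorem IsTwoOuterplane.exists_isVertexExposed [Finite V] (hD : D.IsTwoOuterplane) {v : V}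
    (hv : v ∉ D.faceVerts D.outerFace) : ∃ f, D.IsVertexExposed f ∧ v ∈ D.faceVerts f := by
  set O := D.faceVerts D.outerFace with hO
  set D' := D.induce Oᶜ with hD'
  have hK := D.isPolygonalSet_support
  have hF := D.isRegion_outerFace
  have hF' := D'.isRegion_outerFace
  have hFF' : D.outerFace ⊆ D'.outerFace := unbounded_mono (support_induce_subset Oᶜ)
  have hvF' : D.pos v ∈ frontier D'.outerFace := hD.2.2 ⟨v, hv⟩
  -- The support has measure zero, so it cannot fill a nonempty open part of the outer face of `D'`.
  have hcl : D.pos v ∈ closure (D'.outerFace \ D.support) := by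
    rw [_root_.mem_closure_iff]
    intro o ho hvo
    obtain ⟨z, hz⟩ := _root_.mem_closure_iff.1 hvF'.1 o ho hvo
    by_contra hcon
    rw [not_nonempty_iff_eq_empty] at hcon
    have hsub : o ∩ D'.outerFace ⊆ D.support := fun x hx => by
      by_contra hxK
      exact (hcon.subset ⟨hx.1, hx.2, hxK⟩ : x ∈ (∅ : Set Plane))
    exact (ho.inter hF'.isOpen).measure_ne_zero volume ⟨z, hz⟩
      (measure_mono_null hsub hK.volume_eq_zero)
  obtain ⟨w, hw, f, hf, hwf, hvf⟩ := hK.exists_isRegion disjoint_sdiff_left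
    (D.pos_mem_support v) hcl
  have hne : f ≠ D.outerFace := by
    rintro rfl
    exact hv hvf
  refine ⟨f, ⟨.of_isRegion hf, hne, ?_⟩, hvf⟩
  -- If `f` had no vertex on the outer face, its whole frontier would survive in `D'`. The outer
  -- face of `D'` would then lie in `f`; but it contains the outer face of `D`, which differs from
  -- `f`.
  by_contra hcon
  rw [not_nonempty_iff_eq_empty, ← disjoint_iff_inter_eq_empty] at hcon
  have hdis : Disjoint D'.outerFace (frontier f) := by
    rw [Set.disjoint_left]
    intro z hz hzf
    have hzD' : z ∉ D'.support := Set.disjoint_left.1 hF'.disjoint hz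
    have hvert : ∀ u : V, D.pos u ∈ frontier f → D.pos u ∈ D'.support := fun u hu =>
      D'.pos_mem_support ⟨u, Set.disjoint_left.1 hcon hu⟩
    by_cases hzV : z ∈ range D.pos
    · obtain ⟨u, rfl⟩ := hzV
      exact hzD' (hvert u hzf)
    · rcases hf.frontier_subset hzf with h | h
      · exact hzV h
      simp only [mem_iUnion] at h
      obtain ⟨e, he, hze⟩ := h
      have hsub := hD.1.arc_subset_frontier hf he hze hzV hzf
      induction e using Sym2.ind with
      | _ a b =>
        have ha : a ∉ O := Set.disjoint_left.1 hcon
          (hsub (D.pos_mem_arc he (Sym2.mem_mk_left a b)))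
        have hb : b ∉ O := Set.disjoint_left.1 hcon
          (hsub (D.pos_mem_arc he (Sym2.mem_mk_right a b)))
        exact hzD' (D'.arc_subset_support (e := s(⟨a, ha⟩, ⟨b, hb⟩)) he hze)
  have hsub : D'.outerFace ⊆ f :=
    (isRegion_frontier hf.isOpen hf.isPreconnected hf.nonempty).subset_of_isPreconnected
      hF'.isPreconnected hdis ⟨w, hw.1, hwf⟩
  obtain ⟨c, hc⟩ := hF.nonempty
  exact hne (hf.eq_of_inter_nonempty hF ⟨c, hsub (hFF' hc), hc⟩)

end Drawing

/-! ### Routes from the vertices to the boundary of the outer face. -/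

namespace Drawing

variable {V : Type*} {G : SimpleGraph V} {D : Drawing G}

/-- In an exposed face with few inner vertices, the inner vertices can be joined by disjoint arcs
to points on distinct edges of the outer face. -/
theorem exists_arcs_of_fewInnerVerts [Finite V] {m : Sym2 V → Plane}
    (hm : ∀ e ∈ G.edgeSet, m e ∈ D.arc e ∧ m e ∉ range D.pos) (hD : D.IsPlane) {f : Set Plane}
    (hf : D.IsFace f) (hfew : D.FewInnerVerts f) {Y : Set V}
    (hY : Y ⊆ D.faceVerts f \ D.faceVerts D.outerFace) :
    ∃ (ε : V → Sym2 V) (R : V → Set Plane), ∀ v ∈ Y,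
      ε v ∈ D.faceEdges f ∩ D.faceEdges D.outerFace ∧
      IsPolygonalArc (m (ε v)) (D.pos v) (R v) ∧
      R v ⊆ insert (m (ε v)) (insert (D.pos v) f) ∧
      ∀ v' ∈ Y, v ≠ v' → ε v ≠ ε v' ∧ Disjoint (R v) (R v') := by
  classical
  have hcard : Nat.card Y ≤ Nat.card ↥(D.faceEdges f ∩ D.faceEdges D.outerFace) := by
    rw [Nat.card_coe_set_eq, Nat.card_coe_set_eq]
    exact (ncard_le_ncard hY (toFinite _)).trans hfew
  obtain ⟨η⟩ : Nonempty (Y ↪ ↥(D.faceEdges f ∩ D.faceEdges D.outerFace)) := by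
    cases nonempty_fintype Y
    cases nonempty_fintype ↥(D.faceEdges f ∩ D.faceEdges D.outerFace)
    rw [Nat.card_eq_fintype_card, Nat.card_eq_fintype_card] at hcard
    exact Function.Embedding.nonempty_of_card_le hcard
  have hη : ∀ i, (η i : Sym2 V) ∈ G.edgeSet := fun i => (η i).2.1.1
  have hinj : Function.Injective
      (Sum.elim (fun i : Y => m (η i)) (fun i : Y => D.pos i)) := by
    rw [Sum.elim_injective]
    refine ⟨fun i j hij => ?_, D.pos_injective.comp Subtype.val_injective, fun i j hij => ?_⟩
    · refine η.injective (Subtype.ext (hD.eq_of_mem_arc (hη i) (hη j) (hm _ (hη i)).1 ?_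
        (hm _ (hη i)).2))
      have : m (η i) = m (η j) := hij
      rw [this]
      exact (hm _ (hη j)).1
    · exact (hm _ (hη i)).2 ⟨j, hij.symm⟩
  -- The matching does not let the partners be prescribed: `η` only selects enough edges, and `σ`
  -- tells which vertex gets which edge.
  obtain ⟨σ, R, hR⟩ := hf.isRegion.exists_matching D.isPolygonalSet_support
    (fun i => (η i).2.1.2 (hm _ (hη i)).1) (fun i => (hY i.2).1) hinj
  refine ⟨fun v => if h : v ∈ Y then η (σ.symm ⟨v, h⟩) else s(v, v),
    fun v => if h : v ∈ Y then R (σ.symm ⟨v, h⟩) else ∅, fun v hv => ?_⟩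
  simp only [dif_pos hv]
  have h1 := hR (σ.symm ⟨v, hv⟩)
  rw [Equiv.apply_symm_apply] at h1
  refine ⟨(η _).2, h1.1, h1.2.1, fun v' hv' hne => ?_⟩
  simp only [dif_pos hv']
  have hne' : σ.symm ⟨v, hv⟩ ≠ σ.symm ⟨v', hv'⟩ := by simpa using hne
  exact ⟨fun h => hne' (η.injective (Subtype.ext h)), h1.2.2 _ hne'⟩

/-- Disjoint routes `R v` from points `t v` on the frontier of the outer face to the vertices `v`:
trivial ones for the vertices on the outer face, and routes through an exposed face, starting at an
edge of the outer face used by no other route, for the remaining vertices. -/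
theorem exists_routes [Finite V] (hD : D.IsPlane)
    (hfew : ∀ f, D.IsEdgeExposed f → D.FewInnerVerts f)
    (hexp : ∀ v, v ∉ D.faceVerts D.outerFace → ∃ f, D.IsEdgeExposed f ∧ v ∈ D.faceVerts f) :
    ∃ (t : V → Plane) (R : V → Set Plane), (∀ v, t v ∈ frontier D.outerFace) ∧ (∀ v, t v ∈ R v) ∧
      (∀ v, (t v = D.pos v ∧ R v = {D.pos v}) ∨ (IsPolygonalArc (t v) (D.pos v) (R v) ∧
        t v ∉ range D.pos ∧ ∀ e ∈ G.edgeSet, t v ∈ D.arc e → v ∉ e)) ∧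
      (∀ v v', v ≠ v' → Disjoint (R v) (R v')) ∧
      (∀ v, Disjoint (R v) D.outerFace) ∧ (∀ v, R v ∩ D.support ⊆ {t v, D.pos v}) ∧
      ∀ e ∈ G.edgeSet, ∀ v v', t v ∈ D.arc e → t v' ∈ D.arc e → t v ∉ range D.pos →
        t v' ∉ range D.pos → v = v' := by
  classical
  set F := D.outerFace with hFdef
  have hF : IsRegion D.support F := D.isRegion_outerFace
  -- Fixes one potential crossing point `m e` on each edge and, next, one edge-exposed face `g v`
  -- for each inner vertex, so that every inner vertex is routed once.
  choose! m hm using fun e (he : e ∈ G.edgeSet) => D.exists_mem_arc he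
  choose! g hg hvg using hexp
  have hgR : ∀ v, v ∉ D.faceVerts F → IsRegion D.support (g v) := fun v hv => (hg v hv).1.isRegion
  have harcs : ∀ f, ∃ (ε : V → Sym2 V) (R : V → Set Plane),
      ∀ v, v ∉ D.faceVerts F → g v = f →
      ε v ∈ D.faceEdges f ∩ D.faceEdges F ∧ IsPolygonalArc (m (ε v)) (D.pos v) (R v) ∧
      R v ⊆ insert (m (ε v)) (insert (D.pos v) f) ∧
      ∀ v', v' ∉ D.faceVerts F → g v' = f → v ≠ v' → ε v ≠ ε v' ∧ Disjoint (R v) (R v') := by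
    intro f
    by_cases hf : D.IsEdgeExposed f
    swap
    · exact ⟨fun v => s(v, v), fun _ => ∅, fun v hv hgv => absurd (hgv ▸ hg v hv) hf⟩
    obtain ⟨ε, R, h⟩ := exists_arcs_of_fewInnerVerts hm hD hf.1 (hfew f hf)
      (Y := {v | v ∉ D.faceVerts F ∧ g v = f}) (fun v hv => ⟨hv.2 ▸ hvg v hv.1, hv.1⟩)
    refine ⟨ε, R, fun v hv hgv => ?_⟩
    obtain ⟨h1, h2, h3, h4⟩ := h v ⟨hv, hgv⟩
    exact ⟨h1, h2, h3, fun v' hv' hgv' => h4 v' ⟨hv', hgv'⟩⟩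
  choose ε R hεR using harcs
  have key : ∀ v, v ∉ D.faceVerts F →
      ε (g v) v ∈ D.faceEdges (g v) ∩ D.faceEdges F ∧
      IsPolygonalArc (m (ε (g v) v)) (D.pos v) (R (g v) v) ∧
      R (g v) v ⊆ insert (m (ε (g v) v)) (insert (D.pos v) (g v)) ∧
      ∀ v', v' ∉ D.faceVerts F → g v' = g v → v ≠ v' →
        ε (g v) v ≠ ε (g v) v' ∧ Disjoint (R (g v) v) (R (g v) v') :=
    fun v hv => hεR (g v) v hv rfl
  set E : V → Sym2 V := fun v => ε (g v) v with hE
  set Q : V → Set Plane := fun v => R (g v) v with hQ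
  have hEe : ∀ v, v ∉ D.faceVerts F → E v ∈ G.edgeSet := fun v hv => (key v hv).1.1.1
  have hmK : ∀ v, v ∉ D.faceVerts F → m (E v) ∈ D.support := fun v hv =>
    D.arc_subset_support (hEe v hv) (hm _ (hEe v hv)).1
  have hmV : ∀ v, v ∉ D.faceVerts F → m (E v) ∉ range D.pos := fun v hv => (hm _ (hEe v hv)).2
  have hfK : ∀ v, v ∉ D.faceVerts F → ∀ z ∈ D.support, z ∉ g v := fun v hv z hz hzg =>
    Set.disjoint_left.1 (hgR v hv).disjoint hzg hz
  -- Globally too, no edge is used twice: an edge on the outer face borders at most one other face,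
  -- so equal edges force equal faces, and within a face the edges are distinct.
  have hEinj : ∀ v v', v ∉ D.faceVerts F → v' ∉ D.faceVerts F → E v = E v' → v = v' := by
    intro v v' hv hv' h
    by_contra hne
    have hgg : g v = g v' := by
      refine hD.eq_of_mem_frontier (hgR v hv) (hgR v' hv') hF (hEe v hv) (hm _ (hEe v hv)).1
        (hmV v hv) ((key v hv).1.1.2 (hm _ (hEe v hv)).1) ?_ ((key v hv).1.2.2 (hm _ (hEe v hv)).1)
        (hg v hv).2.1 (hg v' hv').2.1
      rw [h]
      exact (key v' hv').1.1.2 (hm _ (hEe v' hv')).1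
    refine ((key v hv).2.2.2 v' hv' hgg.symm hne).1 ?_
    have : ε (g v) v = ε (g v') v' := h
    rw [this, hgg]
  have hminj : ∀ v v', v ∉ D.faceVerts F → v' ∉ D.faceVerts F → m (E v) = m (E v') → v = v' := by
    intro v v' hv hv' h
    refine hEinj v v' hv hv' (hD.eq_of_mem_arc (hEe v hv) (hEe v' hv') (hm _ (hEe v hv)).1 ?_
      (hmV v hv))
    rw [h]
    exact (hm _ (hEe v' hv')).1
  have hQsub : ∀ v, v ∉ D.faceVerts F → Q v ⊆ insert (m (E v)) (insert (D.pos v) (g v)) :=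
    fun v hv => (key v hv).2.2.1
  have hQdis : ∀ v v', v ∉ D.faceVerts F → v' ∉ D.faceVerts F → v ≠ v' →
      Disjoint (Q v) (Q v') := by
    intro v v' hv hv' hne
    by_cases hgg : g v' = g v
    · have := ((key v hv).2.2.2 v' hv' hgg hne).2
      simp only [hQ]
      rwa [hgg]
    rw [Set.disjoint_left]
    intro z hz hz'
    have hp := fun u => D.pos_mem_support u
    rcases hQsub v hv hz with rfl | rfl | h <;> rcases hQsub v' hv' hz' with h' | h' | h'
    · exact hne (hminj v v' hv hv' h')
    · exact hmV v hv ⟨v', h'.symm⟩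
    · exact hfK v' hv' _ (hmK v hv) h'
    · exact hmV v' hv' ⟨v, h'⟩
    · exact hne (D.pos_injective h')
    · exact hfK v' hv' _ (hp v) h'
    · subst h'; exact hfK v hv _ (hmK v' hv') h
    · rw [mem_singleton_iff.1 h'] at h
      exact hfK v hv _ (hp v') h
    · exact hgg ((hgR v' hv').eq_of_inter_nonempty (hgR v hv) ⟨z, h', h⟩)
  have hQpos : ∀ v v', v ∉ D.faceVerts F → v ≠ v' → D.pos v' ∉ Q v := by
    intro v v' hv hne h
    rcases hQsub v hv h with h | h | h
    · exact hmV v hv ⟨v', h⟩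
    · exact hne (D.pos_injective h).symm
    · exact hfK v hv _ (D.pos_mem_support v') h
  have hFK : ∀ z ∈ D.support, z ∉ F := fun z hz hzF => Set.disjoint_left.1 hF.disjoint hzF hz
  refine ⟨fun v => if v ∈ D.faceVerts F then D.pos v else m (E v),
    fun v => if v ∈ D.faceVerts F then {D.pos v} else Q v, fun v => ?_, fun v => ?_, fun v => ?_,
    fun v v' hne => ?_, fun v => ?_, fun v => ?_, fun e he v v' => ?_⟩
  · by_cases hv : v ∈ D.faceVerts F
    · simp only [if_pos hv]; exact hv
    · simp only [if_neg hv]; exact (key v hv).1.2.2 (hm _ (hEe v hv)).1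
  · by_cases hv : v ∈ D.faceVerts F
    · simp only [if_pos hv]; rfl
    · simp only [if_neg hv]; exact (key v hv).2.1.left_mem
  · by_cases hv : v ∈ D.faceVerts F
    · simp [hv]
    · simp only [if_neg hv]
      refine Or.inr ⟨(key v hv).2.1, hmV v hv, fun e he hme hve => hv ?_⟩
      have : e = E v := hD.eq_of_mem_arc he (hEe v hv) hme (hm _ (hEe v hv)).1 (hmV v hv)
      subst this
      exact faceEdges_subset (key v hv).1.2 hve
  · by_cases hv : v ∈ D.faceVerts F <;> by_cases hv' : v' ∈ D.faceVerts F
    · simp only [if_pos hv, if_pos hv', disjoint_singleton]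
      exact fun h => hne (D.pos_injective h)
    · simp only [if_pos hv, if_neg hv', disjoint_singleton_left]
      exact hQpos v' v hv' hne.symm
    · simp only [if_neg hv, if_pos hv', disjoint_singleton_right]
      exact hQpos v v' hv hne
    · simp only [if_neg hv, if_neg hv']
      exact hQdis v v' hv hv' hne
  · by_cases hv : v ∈ D.faceVerts F
    · simp only [if_pos hv, disjoint_singleton_left]
      exact hFK _ (D.pos_mem_support v)
    · simp only [if_neg hv]
      rw [Set.disjoint_left]
      intro z hz
      rcases hQsub v hv hz with rfl | rfl | h
      · exact hFK _ (hmK v hv)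
      · exact hFK _ (D.pos_mem_support v)
      · exact fun hzF => (hg v hv).2.1 ((hgR v hv).eq_of_inter_nonempty hF ⟨z, h, hzF⟩)
  · by_cases hv : v ∈ D.faceVerts F
    · simp only [if_pos hv]
      rintro z ⟨hz, -⟩
      exact Or.inl hz
    · simp only [if_neg hv]
      rintro z ⟨hz, hzK⟩
      rcases hQsub v hv hz with h | h | h
      · exact Or.inl h
      · exact Or.inr h
      · exact absurd h (hfK v hv z hzK)
  · by_cases hv : v ∈ D.faceVerts F
    · simp only [if_pos hv]
      exact fun _ _ h => absurd ⟨v, rfl⟩ h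
    by_cases hv' : v' ∈ D.faceVerts F
    · simp only [if_pos hv']
      exact fun _ _ _ h => absurd ⟨v', rfl⟩ h
    simp only [if_neg hv, if_neg hv']
    intro h h' _ _
    refine hEinj v v' hv hv' ?_
    rw [← hD.eq_of_mem_arc he (hEe v hv) h (hm _ (hEe v hv)).1 (hmV v hv)]
    exact hD.eq_of_mem_arc he (hEe v' hv') h' (hm _ (hEe v' hv')).1 (hmV v' hv')

end Drawing

/-! ### The drawing of the join. -/

theorem mem_edgeSet_joinGraph {V : Type*} {G : SimpleGraph V} {e : Sym2 (V ⊕ Fin 1)}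
    (he : e ∈ (joinGraph G (pathGraph 1)).edgeSet) :
    (∃ e' ∈ G.edgeSet, e = e'.map Sum.inl) ∨ ∃ v, e = s(.inl v, .inr 0) := by
  induction e using Sym2.ind with
  | _ a b =>
    rw [mem_edgeSet] at he
    rcases a with a | a <;> rcases b with b | b
    · refine Or.inl ⟨s(a, b), ?_, rfl⟩
      simpa [joinGraph] using he
    · exact Or.inr ⟨a, by rw [Subsingleton.elim b 0]⟩
    · exact Or.inr ⟨b, by rw [Subsingleton.elim a 0, Sym2.eq_swap]⟩
    · exact absurd (Subsingleton.elim a b) (fun h => he.ne (congrArg _ h))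

namespace Drawing

variable {V : Type*} {G : SimpleGraph V} {D : Drawing G}

/-- The arcs of the drawing of `G + P₁` obtained from the arcs of `D` by adding the arc `N v` from
the new vertex to `v` for every vertex `v`. -/
def joinArc (D : Drawing G) (N : V → Set Plane) : Sym2 (V ⊕ Fin 1) → Set Plane :=
  Sym2.lift ⟨fun a b => match a, b with
    | .inl u, .inl v => D.arc s(u, v)
    | .inl u, .inr _ => N u
    | .inr _, .inl v => N v
    | .inr _, .inr _ => ∅, by
      rintro (a | a) (b | b)
      · exact congrArg D.arc Sym2.eq_swap
      all_goals rfl⟩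

theorem joinArc_map_inl (D : Drawing G) (N : V → Set Plane) (e : Sym2 V) :
    D.joinArc N (e.map Sum.inl) = D.arc e := by
  induction e using Sym2.ind with
  | _ a b => rfl

/-- If the vertices of a plane drawing can be joined to a new point by arcs crossing the drawing
suitably, then the join with one vertex is 1-planar. -/
theorem IsPlane.onePlanar_joinGraph (hD : D.IsPlane) {p : Plane} (hp : p ∉ D.support)
    {N : V → Set Plane} {t : V → Plane} (hN : ∀ v, IsPolygonalArc p (D.pos v) (N v))
    (hNN : ∀ v v', v ≠ v' → N v ∩ N v' ⊆ {p}) (hNK : ∀ v, N v ∩ D.support ⊆ {t v, D.pos v})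
    (ht : ∀ v, t v ∈ range D.pos → t v = D.pos v)
    (hte : ∀ v, t v ∉ range D.pos → ∀ e ∈ G.edgeSet, t v ∈ D.arc e → v ∉ e)
    (htinj : ∀ e ∈ G.edgeSet, ∀ v v', t v ∈ D.arc e → t v' ∈ D.arc e → t v ∉ range D.pos →
      t v' ∉ range D.pos → v = v') :
    (joinGraph G (pathGraph 1)).OnePlanar := by
  have hpos : ∀ v w, D.pos w ∈ N v → w = v := by
    intro v w hw
    rcases hNK v ⟨hw, D.pos_mem_support w⟩ with h | h
    · exact D.pos_injective (h.trans (ht v ⟨w, h⟩))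
    · exact D.pos_injective h
  have harcN : ∀ v, D.joinArc N s(.inl v, .inr 0) = N v := fun v => rfl
  let D' : Drawing (joinGraph G (pathGraph 1)) :=
    { pos := Sum.elim D.pos fun _ => p
      pos_injective := by
        rw [Sum.elim_injective]
        exact ⟨D.pos_injective, Function.injective_of_subsingleton _,
          fun v _ h => hp (h ▸ D.pos_mem_support v)⟩
      arc := D.joinArc N
      isArc := by
        rintro (u | u) (v | v) h
        · exact D.isArc u v (by simpa [joinGraph] using h)
        · exact (hN u).symm
        · exact hN v
        · exact absurd (Subsingleton.elim u v) (fun h' => h.ne (congrArg _ h'))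
      mem_of_pos_mem := by
        intro e he w hw
        rcases mem_edgeSet_joinGraph he with ⟨e, he₀, rfl⟩ | ⟨v, rfl⟩
        · rw [joinArc_map_inl] at hw
          rcases w with w | w
          · exact Sym2.mem_map.2 ⟨w, D.mem_of_pos_mem e he₀ w hw, rfl⟩
          · exact absurd (D.arc_subset_support he₀ hw) hp
        · rcases w with w | w
          · rw [hpos v w hw]
            exact Sym2.mem_mk_left _ _
          · rw [Subsingleton.elim w 0]
            exact Sym2.mem_mk_right _ _ }
  have hrange : ∀ {z}, z ∉ range D'.pos → z ∉ range D.pos ∧ z ≠ p := fun hz =>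
    ⟨fun ⟨v, h⟩ => hz ⟨.inl v, h⟩, fun h => hz ⟨.inr 0, h.symm⟩⟩
  have hmeet : ∀ e ∈ G.edgeSet, ∀ v z, z ∈ D.arc e → z ∈ N v → z ∉ range D.pos →
      z = t v ∧ t v ∈ D.arc e ∧ t v ∉ range D.pos := by
    intro e he v z hz hzN hzV
    have hzt : z = t v := (hNK v ⟨hzN, D.arc_subset_support he hz⟩).resolve_right
      fun h => hzV ⟨v, h.symm⟩
    exact ⟨hzt, hzt ▸ hz, hzt ▸ hzV⟩
  -- Old edges do not cross one another, and new edges meet one another only at `p`. So every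
  -- crossing pairs an old edge with a new one and sits at some `t v`.
  have hold : ∀ e ∈ G.edgeSet, ∀ c ∈ D'.crossingsOn (e.map Sum.inl), ∃ v,
      c = (s(.inl v, .inr 0), t v) ∧ t v ∈ D.arc e ∧ t v ∉ range D.pos := by
    rintro e he ⟨e', z⟩ ⟨he', hne, hz, hz', hzV⟩
    replace hz : z ∈ D.arc e := by rw [← D.joinArc_map_inl N]; exact hz
    rcases mem_edgeSet_joinGraph he' with ⟨e', he₁, rfl⟩ | ⟨v, rfl⟩
    · replace hz' : z ∈ D.arc e' := by rw [← D.joinArc_map_inl N]; exact hz'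
      exact absurd (congrArg _ (hD.eq_of_mem_arc he₁ he hz' hz (hrange hzV).1)) hne
    · obtain ⟨rfl, h1, h2⟩ := hmeet e he v z hz hz' (hrange hzV).1
      exact ⟨v, rfl, h1, h2⟩
  have hnew : ∀ v, ∀ c ∈ D'.crossingsOn s(.inl v, .inr 0), ∃ e ∈ G.edgeSet,
      c = (e.map Sum.inl, t v) ∧ t v ∈ D.arc e ∧ t v ∉ range D.pos := by
    rintro v ⟨e', z⟩ ⟨he', hne, hz, hz', hzV⟩
    rcases mem_edgeSet_joinGraph he' with ⟨e', he₁, rfl⟩ | ⟨v', rfl⟩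
    · replace hz' : z ∈ D.arc e' := by rw [← D.joinArc_map_inl N]; exact hz'
      obtain ⟨rfl, h1, h2⟩ := hmeet e' he₁ v z hz' hz (hrange hzV).1
      exact ⟨e', he₁, rfl, h1, h2⟩
    · have hvv : v ≠ v' := by
        rintro rfl
        exact hne rfl
      exact absurd (hNN v v' hvv ⟨hz, hz'⟩) (hrange hzV).2
  refine ⟨D', fun e he => ?_, fun e he c hc x hx hxc => ?_⟩
  · intro c hc c' hc'
    rcases mem_edgeSet_joinGraph he with ⟨e, he₁, rfl⟩ | ⟨v, rfl⟩
    · obtain ⟨v, rfl, h1, h2⟩ := hold e he₁ c hc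
      obtain ⟨v', rfl, h1', h2'⟩ := hold e he₁ c' hc'
      rw [htinj e he₁ v v' h1 h1' h2 h2']
    · obtain ⟨e, he, rfl, h1, h2⟩ := hnew v c hc
      obtain ⟨e', he', rfl, h1', h2'⟩ := hnew v c' hc'
      rw [hD.eq_of_mem_arc he he' h1 h1' h2]
  · rcases mem_edgeSet_joinGraph he with ⟨e, he₁, rfl⟩ | ⟨v, rfl⟩
    · obtain ⟨v, rfl, h1, h2⟩ := hold e he₁ c hc
      obtain ⟨y, hy, rfl⟩ := Sym2.mem_map.1 hx
      have hyv : y = v := by simpa using hxc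
      exact hte v h2 e he₁ h1 (hyv ▸ hy)
    · obtain ⟨e, he₁, rfl, h1, h2⟩ := hnew v c hc
      obtain ⟨y, hy, rfl⟩ := Sym2.mem_map.1 hxc
      have hyv : y = v := by simpa using hx
      exact hte v h2 e he₁ h1 (hyv ▸ hy)

/-- The edge to `v` is a star arc in the outer face from `p` to `t v`, followed by the route `R v`.
Routes avoid the outer face, so a star arc can meet a route only at the end `t v` of its own. -/
theorem IsPlane.onePlanar_joinGraph_of_isEdgeExposed [Finite V] (hD : D.IsPlane)
    (hfew : ∀ f, D.IsEdgeExposed f → D.FewInnerVerts f)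
    (hexp : ∀ v, v ∉ D.faceVerts D.outerFace → ∃ f, D.IsEdgeExposed f ∧ v ∈ D.faceVerts f) :
    (joinGraph G (pathGraph 1)).OnePlanar := by
  obtain ⟨t, R, htF, htR, hR, hRR, hRF, hRK, hinj⟩ := exists_routes hD hfew hexp
  have hF := D.isRegion_outerFace
  obtain ⟨p, hp⟩ := hF.nonempty
  have hpK : p ∉ D.support := Set.disjoint_left.1 hF.disjoint hp
  obtain ⟨A, hA⟩ := hF.exists_star D.isPolygonalSet_support hp (T := range t) (finite_range t)
    (by rintro _ ⟨v, rfl⟩; exact htF v)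
  have hti : ∀ v v', v ≠ v' → t v ≠ t v' := fun v v' hne h =>
    Set.disjoint_left.1 (hRR v v' hne) (htR v) (h ▸ htR v')
  have hAR : ∀ v v', A (t v) ∩ R v' ⊆ {t v} := by
    rintro v v' z ⟨hz, hz'⟩
    exact ((hA _ ⟨v, rfl⟩).2.1 hz).resolve_right fun h => Set.disjoint_left.1 (hRF v') hz' h
  have hAR' : ∀ v v', v ≠ v' → Disjoint (A (t v)) (R v') := fun v v' hne =>
    Set.disjoint_left.2 fun z hz hz' => by
      have h : z = t v := hAR v v' ⟨hz, hz'⟩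
      subst h
      exact Set.disjoint_left.1 (hRR v v' hne) (htR v) hz'
  refine hD.onePlanar_joinGraph hpK (N := fun v => A (t v) ∪ R v) (t := t) (fun v => ?_)
    (fun v v' hne => ?_) (fun v => ?_) (fun v hv => ?_) (fun v hv => ?_) hinj
  · rcases hR v with ⟨h1, h2⟩ | ⟨h1, -, -⟩
    · have := (hA _ ⟨v, rfl⟩).1
      rw [h2, union_singleton, ← h1, insert_eq_of_mem this.right_mem]
      exact this
    · exact (hA _ ⟨v, rfl⟩).1.trans h1 (hAR v v)
  · rintro z ⟨hz | hz, hz' | hz'⟩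
    · exact (hA _ ⟨v, rfl⟩).2.2 _ ⟨v', rfl⟩ (hti v v' hne) ⟨hz, hz'⟩
    · exact absurd hz' (Set.disjoint_left.1 (hAR' v v' hne) hz)
    · exact absurd hz (Set.disjoint_left.1 (hAR' v' v hne.symm) hz')
    · exact absurd hz' (Set.disjoint_left.1 (hRR v v' hne) hz)
  · rintro z ⟨hz | hz, hzK⟩
    · exact Or.inl (((hA _ ⟨v, rfl⟩).2.1 hz).resolve_right
        fun h => Set.disjoint_left.1 hF.disjoint h hzK)
    · exact hRK v ⟨hz, hzK⟩
  · exact ((hR v).resolve_right fun h => h.2.1 hv).1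
  · rcases hR v with ⟨h1, -⟩ | ⟨-, -, h3⟩
    · exact absurd ⟨v, h1.symm⟩ hv
    · exact h3

end Drawing

end SimpleGraph

theorem mainTheorem10 {V : Type*} [Finite V] (G : SimpleGraph V)
    (D : SimpleGraph.Drawing G) (hD : D.IsTwoOuterplane) :
    ((∀ f, D.IsVertexExposed f → D.FewInnerVerts f) →
      (SimpleGraph.joinGraph G (SimpleGraph.pathGraph 1)).OnePlanar) ∧
    ((∀ f, D.IsEdgeExposed f → D.FewInnerVerts f) →
      (∀ v, v ∉ D.faceVerts D.outerFace → ∃ f, D.IsEdgeExposed f ∧ v ∈ D.faceVerts f) →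
      (SimpleGraph.joinGraph G (SimpleGraph.pathGraph 1)).OnePlanar) := by
  refine ⟨fun h => hD.1.onePlanar_joinGraph_of_isEdgeExposed
    (fun f hf => h f hf.isVertexExposed) fun v hv => ?_,
    fun h h' => hD.1.onePlanar_joinGraph_of_isEdgeExposed h h'⟩
  obtain ⟨f, hf, hvf⟩ := hD.exists_isVertexExposed hv
  refine ⟨f, ⟨hf.1, hf.2.1, ?_⟩, hvf⟩
  -- The inner vertex `v` on `f` makes `i(f)` positive, hence `c(f)` too, so `f` shares an edge with
  -- the outer face.
  have hpos : 0 < (D.faceVerts f \ D.faceVerts D.outerFace).ncard :=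
    (Set.ncard_pos (Set.toFinite _)).2 ⟨v, hvf, hv⟩
  exact Set.nonempty_of_ncard_ne_zero (hpos.trans_le (h f hf)).ne'
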